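/- Let $\mathbb{K}$ be a field and let $n\ge 2$ be an integer. Let $A=\mathbb{K}[u]$ be the polynomial algebra, graded by $\deg u = 1-n$, either with values in $\mathbb{Z}$ or, after reducing degrees modulo $2$, with values in $\mathbb{Z}/2\mathbb{Z}$. Then $A$ is intrinsically formal as a $\mathbb{Z}$-graded algebra and as a $\mathbb{Z}/2\mathbb{Z}$-graded algebra. That is, for $G=\mathbb{Z}$ and for $G=\mathbb{Z}/2\mathbb{Z}$: if $\mathcal{A}$ is any $G$-graded $A_\infty$-algebra over $\mathbb{K}$ (with operations $\mu^k$ of degree $2-k$ for $k\ge 1$, and no curvature term $\mu^0$) whose cohomology algebra $H^*(\mathcal{A})$, with product $[x]\cdot[y]=(-1)^{|y|}[\mu^2(x,y)]$, is isomorphic to $A$ as a $G$-graded algebra, then $\mathcal{A}$ is quasi-isomorphic to $A$, where $A$ is viewed as an $A_\infty$-algebra with $\mu^2(x,y)=(-1)^{|y|}xy$ and $\mu^k=0$ for $k\ne 2$; explicitly, there is an $A_\infty$-homomorphism $A\to\mathcal{A}$ that induces an isomorphism on cohomology. -/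

import Mathlib

namespace AInf

section Definitions

universe u v w x

/-! Conventions. The grading group `G` is the additive group of a commutative ring with a ring
homomorphism `par : G →+* ZMod 2` (the parity of a degree); it will be `ℤ` with reduction modulo two,
or `ZMod 2` with the identity. A graded vector space is a `K`-module `V` with an internal direct sum
decomposition `𝒱 : G → Submodule K V`. Inputs of multilinear operations are listed from right to left:
for `a : Fin k → V`, the expression `μ k a` stands for the operation usually written
`μ^k (a_k, …, a_1)`, with `a_{i+1} = a i`. -/

/-- The sign `(-1)^z`. -/
def sgn (z : ZMod 2) : ℤ := if z = 0 then 1 else -1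

/-- The parity of `∑_{i < n} (|a_{i+1}| - 1)`, where `g i = |a_{i+1}|`. -/
def maltese {G : Type w} [CommRing G] (par : G →+* ZMod 2) (g : ℕ → G) (n : ℕ) : ZMod 2 :=
  par (∑ i ∈ Finset.range n, (g i - 1))

/-- The sequence `a 0, …, a (n-1), x, a (n+m), a (n+m+1), …`:
the `m` entries `a n, …, a (n+m-1)` are replaced by the single entry `x`. -/
def replaceAt {V : Type v} (a : ℕ → V) (n m : ℕ) (x : V) : ℕ → V := fun i =>
  if i < n then a i else if i = n then x else a (i - 1 + m)

/-- For operations `μ` on `V`, maps `F` from `V` to `W`, and inputs `a` of degrees `g`, the term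
`(-1)^{|a_1| + ⋯ + |a_n| - n}
  F^{n+1+p} (a_{n+m+p}, …, a_{n+m+1}, μ^m (a_{n+m}, …, a_{n+1}), a_n, …, a_1)`. -/
def insertionTerm {K : Type*} {G : Type*} {V : Type*} {W : Type*} [Field K] [CommRing G]
    [AddCommGroup V] [Module K V] [AddCommGroup W] [Module K W] (par : G →+* ZMod 2)
    (μ : ∀ k : ℕ, MultilinearMap K (fun _ : Fin k => V) V)
    (F : ∀ k : ℕ, MultilinearMap K (fun _ : Fin k => V) W)
    (g : ℕ → G) (a : ℕ → V) (n m p : ℕ) : W :=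
  sgn (maltese par g n) •
    F (n + 1 + p) (fun i => replaceAt a n m (μ m (fun j => a (n + j))) i)

/-- The sum of the preceding terms over all `n + m + p = d`. -/
def insertionSum {K : Type*} {G : Type*} {V : Type*} {W : Type*} [Field K] [CommRing G]
    [AddCommGroup V] [Module K V] [AddCommGroup W] [Module K W] (par : G →+* ZMod 2)
    (μ : ∀ k : ℕ, MultilinearMap K (fun _ : Fin k => V) V)
    (F : ∀ k : ℕ, MultilinearMap K (fun _ : Fin k => V) W)
    (g : ℕ → G) (a : ℕ → V) (d : ℕ) : W :=
  ∑ t ∈ Finset.Nat.antidiagonalTuple 3 d, insertionTerm par μ F g a (t 0) (t 1) (t 2)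

/-- An (uncurved) `A_∞`-algebra over a field `K`, on the `G`-graded vector space `(V, 𝒱)`:
operations `μ k` of degree `2 - k` for `k ≥ 1` such that, for all homogeneous inputs,
`∑_{n + m + p = d} (-1)^{|a_1| + ⋯ + |a_n| - n}
  μ^{n+1+p} (a_d, …, a_{n+m+1}, μ^m (a_{n+m}, …, a_{n+1}), a_n, …, a_1) = 0`. -/
structure AInfAlgebra {K : Type u} {G : Type w} {V : Type v} [Field K] [CommRing G] [DecidableEq G]
    [AddCommGroup V] [Module K V] (par : G →+* ZMod 2)
    (𝒱 : G → Submodule K V) [DirectSum.Decomposition 𝒱] where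
  μ : ∀ k : ℕ, MultilinearMap K (fun _ : Fin k => V) V
  μ_zero : μ 0 = 0
  μ_mem : ∀ (k : ℕ) (g : Fin k → G) (a : Fin k → V), (∀ i, a i ∈ 𝒱 (g i)) →
    μ k a ∈ 𝒱 ((∑ i, g i) + (2 - (k : G)))
  relation : ∀ (d : ℕ) (g : ℕ → G) (a : ℕ → V), (∀ i, a i ∈ 𝒱 (g i)) →
    insertionSum par μ μ g a d = 0

/-- An `A_∞`-homomorphism: maps `F k` of degree `1 - k` for `k ≥ 1` such that, for all homogeneous
inputs, `∑ μ^r (F^{s_r} (a_d, …), …, F^{s_1} (a_{s_1}, …, a_1))`, over all `r` and all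
`s_1 + ⋯ + s_r = d` with `s_i ≥ 1`, equals `∑_{n + m + p = d} (-1)^{|a_1| + ⋯ + |a_n| - n}
  F^{n+1+p} (a_d, …, a_{n+m+1}, μ^m (a_{n+m}, …, a_{n+1}), a_n, …, a_1)`. -/
structure AInfHom {K : Type u} {G : Type w} {V : Type*} {W : Type*} [Field K] [CommRing G]
    [DecidableEq G] [AddCommGroup V] [Module K V] [AddCommGroup W] [Module K W]
    {par : G →+* ZMod 2}
    {𝒱 : G → Submodule K V} [DirectSum.Decomposition 𝒱]
    {𝒲 : G → Submodule K W} [DirectSum.Decomposition 𝒲]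
    (M : AInfAlgebra par 𝒱) (N : AInfAlgebra par 𝒲) where
  F : ∀ k : ℕ, MultilinearMap K (fun _ : Fin k => V) W
  F_zero : F 0 = 0
  F_mem : ∀ (k : ℕ) (g : Fin k → G) (a : Fin k → V), (∀ i, a i ∈ 𝒱 (g i)) →
    F k a ∈ 𝒲 ((∑ i, g i) + (1 - (k : G)))
  relation : ∀ (d : ℕ) (g : ℕ → G) (a : ℕ → V), (∀ i, a i ∈ 𝒱 (g i)) →
    ∑ c : Composition d,
      N.μ c.length (fun i => F (c.blocksFun i) (fun j => a (c.embedding i j : ℕ))) =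
      insertionSum par M.μ F g a d

theorem sgn_mul_self (z : ZMod 2) : sgn z * sgn z = 1 := by
  revert z; decide

theorem sgn_add (y z : ZMod 2) : sgn (y + z) = sgn y * sgn z := by
  revert y z; decide

theorem sgn_zero : sgn 0 = 1 := by decide

theorem sgn_one : sgn 1 = -1 := by decide

theorem sgn_sub_one (z : ZMod 2) : sgn (z - 1) = -sgn z := by
  revert z; decide

theorem update_pair_zero {V : Type*} (x y z : V) : Function.update ![x, y] 0 z = ![z, y] := by
  ext i; fin_cases i <;> rfl

theorem update_pair_one {V : Type*} (x y z : V) : Function.update ![x, y] 1 z = ![x, z] := by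
  ext i; fin_cases i <;> rfl

section Cohomology

variable {K : Type u} {G : Type w} {V : Type v} [Field K] [CommRing G] [DecidableEq G]
  [AddCommGroup V] [Module K V] {par : G →+* ZMod 2}
  {𝒱 : G → Submodule K V} [DirectSum.Decomposition 𝒱]

variable (par 𝒱) in
/-- The linear map `x ↦ (-1)^{|x|} x`. -/
noncomputable def signMap : V →ₗ[K] V :=
  (DirectSum.toModule K G V (fun g => sgn (par g) • (𝒱 g).subtype)) ∘ₗ
    (DirectSum.decomposeLinearEquiv 𝒱).toLinearMap

theorem signMap_of_mem {g : G} {x : V} (hx : x ∈ 𝒱 g) :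
    signMap par 𝒱 x = sgn (par g) • x := by
  have h : DirectSum.decomposeLinearEquiv 𝒱 x = DirectSum.lof K G (fun g => 𝒱 g) g ⟨x, hx⟩ :=
    DirectSum.decompose_of_mem 𝒱 hx
  rw [signMap, LinearMap.comp_apply, LinearEquiv.coe_coe, h, DirectSum.toModule_lof]
  rfl

namespace AInfAlgebra

variable (M : AInfAlgebra par 𝒱)

/-- The differential `μ¹`. -/
def d : V →ₗ[K] V where
  toFun x := M.μ 1 (fun _ => x)
  map_add' x y := by
    have h : ∀ z : V, Function.update (fun _ : Fin 1 => (0 : V)) 0 z = fun _ => z := by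
      intro z; ext i; rw [Subsingleton.elim i 0, Function.update_self]
    simpa only [h] using (M.μ 1).map_update_add (fun _ => 0) 0 x y
  map_smul' c x := by
    have h : ∀ z : V, Function.update (fun _ : Fin 1 => (0 : V)) 0 z = fun _ => z := by
      intro z; ext i; rw [Subsingleton.elim i 0, Function.update_self]
    simpa only [h, RingHom.id_apply] using (M.μ 1).map_update_smul (fun _ => 0) 0 c x

/-- The product `(x, y) ↦ (-1)^{|y|} μ² (x, y)`. -/
noncomputable def mul : V →ₗ[K] V →ₗ[K] V :=
  LinearMap.mk₂ K (fun x y => M.μ 2 ![signMap par 𝒱 y, x])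
    (fun x x' y => by
      simpa only [update_pair_one] using
        (M.μ 2).map_update_add ![signMap par 𝒱 y, 0] 1 x x')
    (fun c x y => by
      simpa only [update_pair_one] using
        (M.μ 2).map_update_smul ![signMap par 𝒱 y, 0] 1 c x)
    (fun x y y' => by
      simpa only [update_pair_zero, map_add] using
        (M.μ 2).map_update_add ![0, x] 0 (signMap par 𝒱 y) (signMap par 𝒱 y'))
    (fun c x y => by
      simpa only [update_pair_zero, map_smul] using
        (M.μ 2).map_update_smul ![0, x] 0 c (signMap par 𝒱 y))

theorem d_apply (x : V) : M.d x = M.μ 1 (fun _ => x) := rfl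

theorem mul_apply (x y : V) : M.mul x y = M.μ 2 ![signMap par 𝒱 y, x] := rfl

theorem d_mem {g : G} {x : V} (hx : x ∈ 𝒱 g) : M.d x ∈ 𝒱 (g + 1) := by
  have := M.μ_mem 1 (fun _ => g) (fun _ => x) (fun _ => hx)
  rw [d_apply]
  convert this using 2
  simp
  ring

theorem map_replaceAt_zero {W : Type*} [AddCommGroup W] [Module K W] (n p : ℕ)
    (f : MultilinearMap K (fun _ : Fin (n + 1 + p) => V) W) (a : ℕ → V) (m : ℕ) :
    f (fun i => replaceAt a n m 0 i) = 0 :=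
  f.map_coord_zero ⟨n, by omega⟩ (by simp [replaceAt])

theorem insertionTerm_zero {W : Type*} [AddCommGroup W] [Module K W]
    (F : ∀ k : ℕ, MultilinearMap K (fun _ : Fin k => V) W) (g : ℕ → G) (a : ℕ → V) (n p : ℕ) :
    insertionTerm par M.μ F g a n 0 p = 0 := by
  have h0 : ∀ b : Fin 0 → V, M.μ 0 b = 0 := fun b => by rw [M.μ_zero]; rfl
  rw [insertionTerm, h0, map_replaceAt_zero, smul_zero]

theorem insertionSum_one {W : Type*} [AddCommGroup W] [Module K W]
    (F : ∀ k : ℕ, MultilinearMap K (fun _ : Fin k => V) W) (g : ℕ → G) (a : ℕ → V) :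
    insertionSum par M.μ F g a 1 = F 1 (fun _ => M.d (a 0)) := by
  have h : Finset.Nat.antidiagonalTuple 3 1 = {![0, 0, 1], ![0, 1, 0], ![1, 0, 0]} := by decide
  rw [insertionSum, h, Finset.sum_insert (by decide), Finset.sum_insert (by decide),
    Finset.sum_singleton]
  simp only [Matrix.cons_val_zero, Matrix.cons_val_one, Matrix.cons_val, insertionTerm_zero,
    zero_add, add_zero]
  rw [insertionTerm, maltese, Finset.range_zero, Finset.sum_empty, map_zero, sgn_zero, one_smul]
  refine congrArg (F 1) (funext fun (i : Fin 1) => ?_)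
  rw [Subsingleton.elim i 0]
  simp [replaceAt, d_apply]

theorem insertionSum_two {W : Type*} [AddCommGroup W] [Module K W]
    (F : ∀ k : ℕ, MultilinearMap K (fun _ : Fin k => V) W) (g : ℕ → G) (a : ℕ → V) :
    insertionSum par M.μ F g a 2 = F 1 (fun _ => M.μ 2 ![a 0, a 1]) +
      F 2 ![M.d (a 0), a 1] - sgn (par (g 0)) • F 2 ![a 0, M.d (a 1)] := by
  have h : Finset.Nat.antidiagonalTuple 3 2 = {![0, 2, 0], ![0, 1, 1], ![1, 1, 0],
    ![0, 0, 2], ![1, 0, 1], ![2, 0, 0]} := by decide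
  rw [insertionSum, h, Finset.sum_insert (by decide), Finset.sum_insert (by decide),
    Finset.sum_insert (by decide), Finset.sum_insert (by decide), Finset.sum_insert (by decide),
    Finset.sum_singleton]
  simp only [Matrix.cons_val_zero, Matrix.cons_val_one, Matrix.cons_val, insertionTerm_zero,
    add_zero]
  have e1 : insertionTerm par M.μ F g a 0 2 0 = F 1 (fun _ => M.μ 2 ![a 0, a 1]) := by
    rw [insertionTerm, maltese, Finset.range_zero, Finset.sum_empty, map_zero, sgn_zero, one_smul]
    refine congrArg (F 1) (funext fun (i : Fin 1) => ?_)
    rw [Subsingleton.elim i 0]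
    have : (fun j : Fin 2 => a (0 + j)) = ![a 0, a 1] := by ext j; fin_cases j <;> rfl
    simp only [this]
    simp [replaceAt]
  have e2 : insertionTerm par M.μ F g a 0 1 1 = F 2 ![M.d (a 0), a 1] := by
    rw [insertionTerm, maltese, Finset.range_zero, Finset.sum_empty, map_zero, sgn_zero, one_smul]
    refine congrArg (F 2) (funext fun i => ?_)
    fin_cases i <;> simp [replaceAt, d_apply]
  have e3 : insertionTerm par M.μ F g a 1 1 0 = - (sgn (par (g 0)) • F 2 ![a 0, M.d (a 1)]) := by
    rw [insertionTerm, maltese, Finset.range_one, Finset.sum_singleton, map_sub, map_one,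
      sgn_sub_one, neg_smul]
    refine congrArg (fun z => -(sgn (par (g 0)) • F 2 z)) (funext fun i => ?_)
    fin_cases i <;> simp [replaceAt, d_apply]
  rw [e1, e2, e3, sub_eq_add_neg, add_assoc]

theorem d_d (x : V) : M.d (M.d x) = 0 := by
  induction x using DirectSum.Decomposition.inductionOn 𝒱 with
  | zero => simp
  | add a b ha hb => simp [ha, hb]
  | homogeneous x =>
    rename_i g
    have := M.relation 1 (fun _ => g) (fun _ => (x : V)) (fun _ => x.2)
    rwa [insertionSum_one] at this

theorem d_μ_two {g h : G} {x y : V} (hx : x ∈ 𝒱 g) (hy : y ∈ 𝒱 h) :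
    M.d (M.μ 2 ![y, x]) + M.μ 2 ![M.d y, x] - sgn (par h) • M.μ 2 ![y, M.d x] = 0 := by
  have := M.relation 2 (fun i => if i = 0 then h else g) (fun i => if i = 0 then y else x)
    (fun i => by split_ifs <;> assumption)
  rwa [insertionSum_two] at this

theorem signMap_signMap (x : V) : signMap par 𝒱 (signMap par 𝒱 x) = x := by
  induction x using DirectSum.Decomposition.inductionOn 𝒱 with
  | zero => simp
  | add a b ha hb => simp [ha, hb]
  | homogeneous x =>
    rw [signMap_of_mem x.2, map_zsmul, signMap_of_mem x.2, smul_smul, sgn_mul_self, one_smul]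

theorem d_signMap (x : V) : M.d (signMap par 𝒱 x) = -signMap par 𝒱 (M.d x) := by
  induction x using DirectSum.Decomposition.inductionOn 𝒱 with
  | zero => simp
  | add a b ha hb => rw [map_add, map_add, ha, hb, map_add, map_add, neg_add]
  | homogeneous x =>
    rw [signMap_of_mem x.2, map_zsmul, signMap_of_mem (M.d_mem x.2), map_add, map_one, sgn_add,
      sgn_one]
    simp

/-- The Leibniz rule. -/
theorem d_mul (x y : V) :
    M.d (M.mul x y) = M.mul x (M.d y) + M.mul (M.d x) (signMap par 𝒱 y) := by
  induction x using DirectSum.Decomposition.inductionOn 𝒱 with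
  | zero => simp
  | add a b ha hb => simp only [map_add, LinearMap.add_apply, ha, hb]; abel
  | homogeneous x =>
    induction y using DirectSum.Decomposition.inductionOn 𝒱 with
    | zero => simp
    | add a b ha hb => simp only [map_add, ha, hb]; abel
    | homogeneous y =>
      have h := M.d_μ_two x.2 y.2
      have e : ∀ (c : ℤ) (u v : V), M.μ 2 ![c • u, v] = c • M.μ 2 ![u, v] := by
        intro c u v
        have := (M.μ 2).map_update_smul ![0, v] 0 (c : K) u
        simpa only [update_pair_zero, Int.cast_smul_eq_zsmul] using this
      rw [mul_apply, mul_apply, mul_apply, signMap_signMap, signMap_of_mem y.2,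
        signMap_of_mem (M.d_mem y.2), e, e, map_zsmul, map_add, map_one, sgn_add, sgn_one]
      rw [sub_eq_zero, ← eq_sub_iff_add_eq] at h
      rw [h, smul_sub, smul_smul, sgn_mul_self]
      simp only [one_smul, mul_neg, mul_one, neg_smul]
      abel

variable (par 𝒱) in
theorem signMap_ker {y : V} (hy : y ∈ LinearMap.ker M.d) :
    signMap par 𝒱 y ∈ LinearMap.ker M.d := by
  rw [LinearMap.mem_ker] at hy ⊢
  rw [d_signMap, hy, map_zero, neg_zero]

/-- The product of cocycles. -/
noncomputable def cocycleMul :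
    LinearMap.ker M.d →ₗ[K] LinearMap.ker M.d →ₗ[K] LinearMap.ker M.d :=
  LinearMap.mk₂ K
    (fun x y => ⟨M.mul x y, by
      have hx := x.2
      have hy := y.2
      rw [LinearMap.mem_ker] at hx hy ⊢
      rw [d_mul, hx, hy]
      simp⟩)
    (fun x x' y => by ext; simp)
    (fun c x y => by ext; simp)
    (fun x y y' => by ext; simp)
    (fun c x y => by ext; simp)

/-- The coboundaries, as a subspace of the cocycles. -/
def coboundaries : Submodule K (LinearMap.ker M.d) :=
  (LinearMap.range M.d).comap (LinearMap.ker M.d).subtype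

/-- The cohomology `ker μ¹ / im μ¹`. -/
abbrev Cohomology : Type v := LinearMap.ker M.d ⧸ M.coboundaries

/-- The degree `g` part of the cohomology: the classes of the cocycles of degree `g`. -/
def cohomologyGrading (g : G) : Submodule K M.Cohomology :=
  ((𝒱 g).comap (LinearMap.ker M.d).subtype).map M.coboundaries.mkQ

theorem mul_mem_range_left {x y : V} (hx : x ∈ LinearMap.range M.d)
    (hy : y ∈ LinearMap.ker M.d) : M.mul x y ∈ LinearMap.range M.d := by
  obtain ⟨w, rfl⟩ := hx
  rw [LinearMap.mem_ker] at hy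
  exact ⟨M.mul w (signMap par 𝒱 y), by rw [d_mul, d_signMap, hy, signMap_signMap]; simp⟩

theorem mul_mem_range_right {x y : V} (hx : x ∈ LinearMap.ker M.d)
    (hy : y ∈ LinearMap.range M.d) : M.mul x y ∈ LinearMap.range M.d := by
  obtain ⟨w, rfl⟩ := hy
  rw [LinearMap.mem_ker] at hx
  exact ⟨M.mul x w, by rw [d_mul, hx]; simp⟩

/-- The product on cohomology, `[x] [y] = (-1)^{|y|} [μ² (x, y)]`. -/
noncomputable def cohomologyMul : M.Cohomology →ₗ[K] M.Cohomology →ₗ[K] M.Cohomology :=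
  M.coboundaries.liftQ
    (M.coboundaries.liftQ (M.cocycleMul.compr₂ M.coboundaries.mkQ).flip (by
      intro y hy
      rw [LinearMap.mem_ker]
      ext x
      exact (Submodule.Quotient.mk_eq_zero _).2 (M.mul_mem_range_right x.2 hy))).flip (by
    intro x hx
    rw [LinearMap.mem_ker]
    ext y
    exact (Submodule.Quotient.mk_eq_zero _).2 (M.mul_mem_range_left hx y.2))

theorem cohomologyMul_mk (x y : LinearMap.ker M.d) :
    M.cohomologyMul (M.coboundaries.mkQ x) (M.coboundaries.mkQ y) =
      M.coboundaries.mkQ (M.cocycleMul x y) := rfl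

/-- An isomorphism of graded algebras from a graded algebra `(A, 𝒜)` to the cohomology algebra. -/
structure CohomologyIso {A : Type*} [Ring A] [Algebra K A] (𝒜 : G → Submodule K A) where
  toEquiv : A ≃ₗ[K] M.Cohomology
  map_grading : ∀ g, (𝒜 g).map toEquiv.toLinearMap = M.cohomologyGrading g
  map_mul : ∀ x y, toEquiv (x * y) = M.cohomologyMul (toEquiv x) (toEquiv y)

end AInfAlgebra

namespace AInfHom

variable {W : Type*} [AddCommGroup W] [Module K W]
  {𝒲 : G → Submodule K W} [DirectSum.Decomposition 𝒲]
  {M : AInfAlgebra par 𝒱} {N : AInfAlgebra par 𝒲} (f : AInfHom M N)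

/-- The linear part `F¹`. -/
def linearPart : V →ₗ[K] W where
  toFun x := f.F 1 (fun _ => x)
  map_add' x y := by
    have h : ∀ z : V, Function.update (fun _ : Fin 1 => (0 : V)) 0 z = fun _ => z := by
      intro z; ext i; rw [Subsingleton.elim i 0, Function.update_self]
    simpa only [h] using (f.F 1).map_update_add (fun _ => 0) 0 x y
  map_smul' c x := by
    have h : ∀ z : V, Function.update (fun _ : Fin 1 => (0 : V)) 0 z = fun _ => z := by
      intro z; ext i; rw [Subsingleton.elim i 0, Function.update_self]
    simpa only [h, RingHom.id_apply] using (f.F 1).map_update_smul (fun _ => 0) 0 c x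

theorem linearPart_d (x : V) : N.d (f.linearPart x) = f.linearPart (M.d x) := by
  induction x using DirectSum.Decomposition.inductionOn 𝒱 with
  | zero => simp
  | add a b ha hb => simp [ha, hb]
  | homogeneous x =>
    rename_i g
    have h := f.relation 1 (fun _ => g) (fun _ => (x : V)) (fun _ => x.2)
    rw [AInfAlgebra.insertionSum_one] at h
    have hu : (Finset.univ : Finset (Composition 1)) = {Composition.single 1 one_pos} := by
      have : Subsingleton (Composition 1) :=
        Fintype.card_le_one_iff_subsingleton.1 (by rw [composition_card]; simp)
      ext c
      simp [Subsingleton.elim c (Composition.single 1 one_pos)]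
    rw [hu, Finset.sum_singleton] at h
    refine Eq.trans ?_ h
    refine congrArg (N.μ 1) (funext fun i => ?_)
    rw [Subsingleton.elim i 0]
    rfl

/-- The map induced on cohomology. -/
def cohomologyMap : M.Cohomology →ₗ[K] N.Cohomology :=
  M.coboundaries.mapQ N.coboundaries
    (f.linearPart.restrict (fun x hx => by
      rw [LinearMap.mem_ker] at hx ⊢
      rw [linearPart_d, hx, map_zero]))
    (by
      rintro x ⟨w, hw⟩
      exact ⟨f.linearPart w, by rw [linearPart_d, hw]; rfl⟩)

/-- A quasi-isomorphism: the induced map on cohomology is bijective. -/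
def IsQuasiIso : Prop := Function.Bijective f.cohomologyMap

end AInfHom

/-- There is an `A_∞`-quasi-isomorphism from `M` to `N` (over a field such a map has an inverse up to
homotopy, so this is a symmetric relation). -/
def QuasiIsomorphic {W : Type*} [AddCommGroup W] [Module K W]
    {𝒲 : G → Submodule K W} [DirectSum.Decomposition 𝒲]
    (M : AInfAlgebra par 𝒱) (N : AInfAlgebra par 𝒲) : Prop :=
  ∃ f : AInfHom M N, f.IsQuasiIso

end Cohomology

section Graded

variable {K : Type u} {G : Type w} {A : Type v} [Field K] [CommRing G] [DecidableEq G]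
  [Ring A] [Algebra K A]

variable (K A) in
/-- The multiplication `![y, x] ↦ x * y`. -/
def mulRev : MultilinearMap K (fun _ : Fin 2 => A) A where
  toFun a := a 1 * a 0
  map_update_add' a i x y := by
    fin_cases i <;> simp [Function.update, mul_add, add_mul]
  map_update_smul' a i c x := by
    fin_cases i <;> simp [Function.update]

/-- The operations of a graded algebra, seen as an `A_∞`-algebra:
`μ² (x, y) = (-1)^{|y|} x y`, and all other operations vanish. -/
noncomputable def gradedμ (par : G →+* ZMod 2) (𝒜 : G → Submodule K A)
    [DirectSum.Decomposition 𝒜] : ∀ k : ℕ, MultilinearMap K (fun _ : Fin k => A) A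
  | 2 => (mulRev K A).compLinearMap ![signMap par 𝒜, LinearMap.id]
  | _ => 0

theorem gradedμ_of_ne (par : G →+* ZMod 2) (𝒜 : G → Submodule K A)
    [DirectSum.Decomposition 𝒜] {k : ℕ} (hk : k ≠ 2) : gradedμ par 𝒜 k = 0 := by
  unfold gradedμ
  split
  · exact absurd rfl hk
  · rfl

theorem gradedμ_two (par : G →+* ZMod 2) (𝒜 : G → Submodule K A)
    [DirectSum.Decomposition 𝒜] (a : Fin 2 → A) :
    gradedμ par 𝒜 2 a = a 1 * signMap par 𝒜 (a 0) := rfl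

theorem insertionTerm_gradedμ (par : G →+* ZMod 2) (𝒜 : G → Submodule K A)
    [DirectSum.Decomposition 𝒜] (g : ℕ → G) (a : ℕ → A) (n m p : ℕ) (h : m ≠ 2 ∨ n + 1 + p ≠ 2) :
    insertionTerm par (gradedμ par 𝒜) (gradedμ par 𝒜) g a n m p = 0 := by
  by_cases hm : m = 2
  · have hn : n + 1 + p ≠ 2 := h.resolve_left (not_not.2 hm)
    rw [insertionTerm, gradedμ_of_ne par 𝒜 hn]
    exact smul_zero _
  · have h0 : ∀ b : Fin m → A, gradedμ par 𝒜 m b = 0 := fun b => by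
      rw [gradedμ_of_ne par 𝒜 hm]; rfl
    rw [insertionTerm, h0, AInfAlgebra.map_replaceAt_zero, smul_zero]

/-- A graded algebra, seen as an `A_∞`-algebra. -/
noncomputable def ofGradedAlgebra (par : G →+* ZMod 2) (𝒜 : G → Submodule K A)
    [GradedAlgebra 𝒜] : AInfAlgebra par 𝒜 where
  μ := gradedμ par 𝒜
  μ_zero := rfl
  μ_mem k g a ha := by
    by_cases hk : k = 2
    · subst hk
      rw [gradedμ_two, signMap_of_mem (ha 0), mul_smul_comm]
      refine zsmul_mem ?_ _
      have h := SetLike.mul_mem_graded (ha 1) (ha 0)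
      rw [Fin.sum_univ_two, Nat.cast_ofNat, sub_self, add_zero, add_comm]
      exact h
    · rw [gradedμ_of_ne par 𝒜 hk]
      exact zero_mem _
  relation d g a ha := by
    by_cases hd : d = 3
    · subst hd
      have h : Finset.Nat.antidiagonalTuple 3 3 = {![0, 2, 1], ![1, 2, 0]} ∪
          (Finset.Nat.antidiagonalTuple 3 3).filter (fun t => t 1 ≠ 2) := by decide
      rw [insertionSum, h, Finset.sum_union (by decide),
        Finset.sum_eq_zero (s := Finset.filter _ _) (fun t ht =>
          insertionTerm_gradedμ par 𝒜 g a _ _ _ (Or.inl (Finset.mem_filter.1 ht).2)), add_zero,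
        Finset.sum_insert (by decide), Finset.sum_singleton]
      simp only [Matrix.cons_val_zero, Matrix.cons_val_one, Matrix.cons_val]
      have h1 : insertionTerm par (gradedμ par 𝒜) (gradedμ par 𝒜) g a 0 2 1 =
          a 2 * signMap par 𝒜 (a 1 * signMap par 𝒜 (a 0)) := by
        rw [insertionTerm, maltese, Finset.range_zero, Finset.sum_empty, map_zero, sgn_zero,
          one_smul, gradedμ_two]
        rfl
      have h2 : insertionTerm par (gradedμ par 𝒜) (gradedμ par 𝒜) g a 1 2 0 =
          -(sgn (par (g 0)) • (a 2 * signMap par 𝒜 (a 1) * signMap par 𝒜 (a 0))) := by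
        rw [insertionTerm, maltese, Finset.range_one, Finset.sum_singleton, map_sub, map_one,
          sgn_sub_one, neg_smul, gradedμ_two]
        rfl
      rw [h1, h2, signMap_of_mem (ha 0), signMap_of_mem (ha 1), mul_smul_comm, map_zsmul,
        signMap_of_mem (SetLike.mul_mem_graded (ha 1) (ha 0)), map_add, sgn_add]
      simp only [mul_smul_comm, smul_mul_assoc, smul_smul, mul_assoc]
      rw [← sub_eq_add_neg, sub_eq_zero]
      congr 1
      ring
    · refine Finset.sum_eq_zero fun t ht => insertionTerm_gradedμ par 𝒜 g a _ _ _ ?_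
      rw [Finset.Nat.mem_antidiagonalTuple, Fin.sum_univ_three] at ht
      omega

/-- A graded algebra `(A, 𝒜)` is intrinsically formal if every `A_∞`-algebra whose cohomology algebra
is isomorphic to it is quasi-isomorphic to it. -/
def IntrinsicallyFormal (par : G →+* ZMod 2) (𝒜 : G → Submodule K A) [GradedAlgebra 𝒜] : Prop :=
  ∀ (V : Type x) [AddCommGroup V] [Module K V] (𝒱 : G → Submodule K V)
    [DirectSum.Decomposition 𝒱] (M : AInfAlgebra par 𝒱),
    Nonempty (M.CohomologyIso 𝒜) → QuasiIsomorphic (ofGradedAlgebra par 𝒜) M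

end Graded

/-- The grading of `K[u]` by `G` in which `u` has degree `δ`: the degree `g` part is spanned by the
monomials `u ^ k` with `k δ = g`. -/
noncomputable def polynomialGrading (K : Type u) {G : Type w} [Field K] [CommRing G] (δ : G) (g : G) :
    Submodule K (Polynomial K) :=
  Submodule.span K {p | ∃ k : ℕ, (k : G) * δ = g ∧ p = Polynomial.X ^ k}

noncomputable instance (K : Type u) {G : Type w} [Field K] [CommRing G] [DecidableEq G] (δ : G) :
    GradedAlgebra (polynomialGrading K δ) := by
  haveI : SetLike.GradedMonoid (polynomialGrading K δ) :=
    { one_mem := Submodule.subset_span ⟨0, by simp, by simp⟩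
      mul_mem := by
        intro i j p q hp hq
        have h := Submodule.mul_mem_mul hp hq
        rw [polynomialGrading, polynomialGrading, Submodule.span_mul_span] at h
        refine Submodule.span_mono ?_ h
        rintro _ ⟨_, ⟨k, hk, rfl⟩, _, ⟨l, hl, rfl⟩, rfl⟩
        exact ⟨k + l, by push_cast; rw [add_mul, hk, hl], by simp [pow_add]⟩ }
  refine GradedAlgebra.ofAlgHom _
    (Polynomial.aeval (DirectSum.of (fun g => polynomialGrading K δ g) δ
      ⟨Polynomial.X, Submodule.subset_span ⟨1, by simp, by simp⟩⟩)) ?_ ?_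
  · ext
    simp
  · rintro g ⟨p, hp⟩
    change _ = DirectSum.of (fun g => polynomialGrading K δ g) g ⟨p, hp⟩
    induction hp using Submodule.span_induction with
    | mem p h =>
      obtain ⟨k, hk, rfl⟩ := h
      rw [map_pow, Polynomial.aeval_X, DirectSum.ofPow]
      refine DirectSum.of_eq_of_gradedMonoid_eq (Sigma.subtype_ext ?_ rfl)
      exact (nsmul_eq_mul k δ).trans hk
    | zero => rw [map_zero]; exact (map_zero _).symm
    | add p q hp hq h1 h2 => rw [map_add, h1, h2, ← map_add]; rfl
    | smul c p hp h =>
      rw [map_smul, h]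
      exact ((DirectSum.lof K G (fun g => polynomialGrading K δ g) g).map_smul c ⟨p, hp⟩).symm

end Definitions
end AInf

/-!
The algebra `K[u]` is free on one generator, so that its Hochschild cohomology with values in itself
vanishes in degrees at least two, whatever the degree of `u`; this is what makes it intrinsically
formal. Let `e` be an isomorphism of `K[u]` with the cohomology of the `A_∞`-algebra `M`.

Since the monomials are a homogeneous basis, an `A_∞`-homomorphism from `K[u]` to `M` is the same as a
family of vectors `f l`, indexed by the lists `l` of exponents, of degrees `rdeg δ l + 1`. Its equations
say that the `defect` of `f` vanishes: this is the sum of the operations of `M` over all decompositions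
of `l` into blocks, minus the signed sum `merge` over all ways to add up two neighbouring exponents. The
`A_∞`-relations of `M`, together with `merge_merge`, give a linear equation for the defect of an
arbitrary family, `defect_equation`. It is the component form of the identity `b D + D b = 0`, with
`D` the commutator of the map of bar constructions with the differentials `b`.

Suppose that the defect vanishes on lists of length at most `d`, with `d ≥ 2`. By the equation, the
defects of length `d + 1` are cocycles, and their classes form a Hochschild cocycle of `K[u]`. It is a
coboundary by `coboundary_primitive`, where a primitive is written down explicitly: inserting the unit
determines it on lists that begin with `0` or `1`, and a recursion on the first exponent does the
rest. Changing `f` in length `d` by cocycles that represent the primitive makes the defects of length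
`d + 1` exact, and a change of `f` in length `d + 1` then removes them; this is
`exists_isPartialHom_succ`. The recursion starts with representatives of the classes of the monomials,
for which multiplicativity of `e` is the vanishing of the obstruction in length two, and it stabilizes
on lists of each length. The limit extends to a multilinear family on `K[u]`
(`homOfDefectEqZero`), whose linear part induces `e` on cohomology.

Signs enter only through `τ = (-1)^{|u|}`, so that the argument is uniform in the grading group.
-/

namespace AInf

/-! ### Splittings and block decompositions of lists -/

section Lists

variable {α : Type*} [DecidableEq α]

/-- The triples `(P, Q, R)` of lists with `P ++ Q ++ R = l`. -/
def splits (l : List α) : Finset (List α × List α × List α) :=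
  (Finset.Nat.antidiagonalTuple 3 l.length).image fun t =>
    (l.take (t 0), (l.drop (t 0)).take (t 1), (l.drop (t 0)).drop (t 1))

theorem mem_splits {l : List α} {t : List α × List α × List α} :
    t ∈ splits l ↔ t.1 ++ (t.2.1 ++ t.2.2) = l := by
  simp only [splits, Finset.mem_image, Finset.Nat.mem_antidiagonalTuple]
  constructor
  · rintro ⟨t, -, rfl⟩
    simp
  · obtain ⟨P, Q, R⟩ := t
    rintro rfl
    refine ⟨![P.length, Q.length, R.length], ?_, ?_⟩
    · simp [Fin.sum_univ_three]; ring
    · simp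

variable {N : Type*} [AddCommMonoid N]

theorem sum_splits (l : List α) (h : List α → List α → List α → N) :
    ∑ t ∈ splits l, h t.1 t.2.1 t.2.2 = ∑ t ∈ Finset.Nat.antidiagonalTuple 3 l.length,
      h (l.take (t 0)) ((l.drop (t 0)).take (t 1)) ((l.drop (t 0)).drop (t 1)) := by
  rw [splits, Finset.sum_image]
  intro t ht s hs hts
  simp only [Finset.mem_coe, Finset.Nat.mem_antidiagonalTuple, Fin.sum_univ_three] at ht hs
  simp only [Prod.mk.injEq] at hts
  have h0 := congrArg List.length hts.1
  have h1 := congrArg List.length hts.2.1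
  simp only [List.length_take, List.length_drop] at h0 h1
  ext i
  fin_cases i <;> simp <;> omega

theorem sum_splits_nil (h : List α → List α → List α → N) :
    ∑ t ∈ splits ([] : List α), h t.1 t.2.1 t.2.2 = h [] [] [] := by
  rw [Finset.sum_eq_single ([], [], [])]
  · rintro ⟨P, Q, R⟩ ht hne
    simp [mem_splits] at ht
    simp [ht] at hne
  · intro ht
    simp [mem_splits] at ht

theorem sum_splits_cons (x : α) (l : List α) (h : List α → List α → List α → N) :
    ∑ t ∈ splits (x :: l), h t.1 t.2.1 t.2.2 =
      ∑ t ∈ (splits (x :: l)).filter (fun t => t.1 = []), h [] t.2.1 t.2.2 +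
      ∑ t ∈ splits l, h (x :: t.1) t.2.1 t.2.2 := by
  rw [← Finset.sum_filter_add_sum_filter_not (splits (x :: l)) (fun t => t.1 = [])]
  congr 1
  · refine Finset.sum_congr rfl fun t ht => ?_
    rw [(Finset.mem_filter.1 ht).2]
  · symm
    refine Finset.sum_bij (fun t _ => (x :: t.1, t.2)) ?_ ?_ ?_ ?_
    · rintro ⟨P, Q, R⟩ ht
      simpa [mem_splits] using ht
    · rintro ⟨P, Q, R⟩ - ⟨P', Q', R'⟩ - h
      simpa using h
    · rintro ⟨P, Q, R⟩ ht
      simp only [Finset.mem_filter, mem_splits] at ht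
      obtain ⟨ht, hP⟩ := ht
      obtain ⟨y, P, rfl⟩ := List.exists_cons_of_ne_nil hP
      simp only [List.cons_append, List.cons.injEq] at ht
      exact ⟨(P, Q, R), mem_splits.2 ht.2, by simp [ht.1]⟩
    · intros; rfl

/-- The decompositions of a list into consecutive nonempty blocks. -/
def blockings (l : List α) : Finset (List (List α)) :=
  Finset.univ.image fun c : Composition l.length => l.splitWrtComposition c

theorem mem_blockings {l : List α} {C : List (List α)} :
    C ∈ blockings l ↔ C.flatten = l ∧ [] ∉ C := by
  simp only [blockings, Finset.mem_image, Finset.mem_univ, true_and]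
  constructor
  · rintro ⟨c, rfl⟩
    refine ⟨l.flatten_splitWrtComposition c, fun h => ?_⟩
    simpa using List.length_pos_of_mem_splitWrtComposition h
  · rintro ⟨rfl, h⟩
    refine ⟨⟨C.map List.length, ?_, ?_⟩, List.splitWrtComposition_flatten C _ rfl⟩
    · intro i hi
      obtain ⟨b, hb, rfl⟩ := List.mem_map.1 hi
      exact List.length_pos_of_ne_nil fun hb' => h (hb' ▸ hb)
    · rw [List.length_flatten]

theorem sum_blockings (l : List α) (ψ : List (List α) → N) :
    ∑ C ∈ blockings l, ψ C = ∑ c : Composition l.length, ψ (l.splitWrtComposition c) := by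
  rw [blockings, Finset.sum_image]
  intro c _ c' _ h
  have := congrArg (List.map List.length) h
  rw [List.map_length_splitWrtComposition, List.map_length_splitWrtComposition] at this
  exact Composition.ext this

/-- Splitting a block decomposition of `l` in three is the same as splitting `l` in three, and then
decomposing the three parts into blocks. -/
theorem sum_blockings_splits (l : List α)
    (h : List (List α) → List (List α) → List (List α) → N) :
    ∑ C ∈ blockings l, ∑ t ∈ splits C, h t.1 t.2.1 t.2.2 =
      ∑ t ∈ splits l, ∑ P ∈ blockings t.1, ∑ R ∈ blockings t.2.2, ∑ Q ∈ blockings t.2.1,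
        h P Q R := by
  simp only [← Finset.sum_product', Finset.sum_sigma']
  refine Finset.sum_bij'
    (fun s _ => ⟨(s.2.1.flatten, s.2.2.1.flatten, s.2.2.2.flatten),
      (s.2.1, s.2.2.2, s.2.2.1)⟩)
    (fun s _ => ⟨s.2.1 ++ (s.2.2.2 ++ s.2.2.1), (s.2.1, s.2.2.2, s.2.2.1)⟩) ?_ ?_ ?_ ?_ ?_
  · rintro ⟨C, P, Q, R⟩ hs
    simp only [Finset.mem_sigma, mem_blockings, mem_splits, Finset.mem_product] at hs ⊢
    obtain ⟨⟨rfl, h⟩, rfl⟩ := hs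
    simp only [List.mem_append, not_or] at h
    simp [h]
  · rintro ⟨⟨a, b, c⟩, P, R, Q⟩ hs
    simp only [Finset.mem_sigma, mem_blockings, mem_splits, Finset.mem_product] at hs ⊢
    obtain ⟨rfl, ⟨rfl, hP⟩, ⟨rfl, hR⟩, ⟨rfl, hQ⟩⟩ := hs
    simp [hP, hQ, hR]
  · rintro ⟨C, P, Q, R⟩ hs
    simp only [Finset.mem_sigma, mem_blockings, mem_splits] at hs ⊢
    obtain ⟨⟨rfl, h⟩, rfl⟩ := hs
    rfl
  · rintro ⟨⟨a, b, c⟩, P, R, Q⟩ hs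
    simp only [Finset.mem_sigma, mem_blockings, mem_splits, Finset.mem_product] at hs ⊢
    obtain ⟨rfl, ⟨rfl, hP⟩, ⟨rfl, hR⟩, ⟨rfl, hQ⟩⟩ := hs
    rfl
  · intros; rfl

theorem sum_blockings_nil (ψ : List (List α) → N) :
    ∑ C ∈ blockings ([] : List α), ψ C = ψ [] := by
  rw [Finset.sum_eq_single []]
  · intro C hC hne
    rw [mem_blockings, List.flatten_eq_nil_iff] at hC
    obtain ⟨b, C, rfl⟩ := List.exists_cons_of_ne_nil hne
    exact absurd (hC.1 b (by simp)) (fun h => hC.2 (by simp [h]))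
  · intro h
    simp [mem_blockings] at h

theorem sum_blockings_singleton (x : α) (ψ : List (List α) → N) :
    ∑ C ∈ blockings [x], ψ C = ψ [[x]] := by
  rw [Finset.sum_eq_single [[x]]]
  · intro C hC hne
    rw [mem_blockings] at hC
    obtain ⟨h, hn⟩ := hC
    rcases C with _ | ⟨_ | ⟨y, b⟩, C⟩
    · simp at h
    · simp at hn
    · simp only [List.flatten_cons, List.cons_append, List.cons.injEq, List.append_eq_nil_iff,
        List.flatten_eq_nil_iff] at h
      obtain ⟨rfl, rfl, h⟩ := h
      rcases C with _ | ⟨c, C⟩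
      · simp at hne
      · exact absurd (h c (by simp)) (fun h => hn (by simp [h]))
  · intro h
    simp [mem_blockings] at h

/-- Put `x` in front of the first block. -/
def consHead (x : α) : List (List α) → List (List α)
  | [] => [[x]]
  | b :: C => (x :: b) :: C

/-- In a block decomposition of `x :: y :: l`, either `x` is a block of its own, or it is the first
entry of the block that contains `y`. -/
theorem sum_blockings_cons_cons (x y : α) (l : List α) (ψ : List (List α) → N) :
    ∑ C ∈ blockings (x :: y :: l), ψ C =
      ∑ C ∈ blockings (y :: l), ψ ([x] :: C) + ∑ C ∈ blockings (y :: l), ψ (consHead x C) := by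
  rw [← Finset.sum_filter_add_sum_filter_not (blockings (x :: y :: l)) (fun C => C.head? = some [x])]
  congr 1
  · symm
    refine Finset.sum_bij (fun C _ => [x] :: C) ?_ ?_ ?_ ?_
    · intro C hC
      simpa [mem_blockings] using hC
    · rintro C - C' - h
      simpa using h
    · intro C hC
      rw [Finset.mem_filter, mem_blockings] at hC
      obtain ⟨⟨h1, h2⟩, h3⟩ := hC
      rcases C with _ | ⟨b, C⟩
      · simp at h3
      · simp only [List.head?_cons, Option.some.injEq] at h3
        subst h3
        exact ⟨C, by simpa [mem_blockings] using And.intro h1 h2, rfl⟩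
    · intros; rfl
  · symm
    refine Finset.sum_bij (fun C _ => consHead x C) ?_ ?_ ?_ ?_
    · intro C hC
      rcases C with _ | ⟨b, C⟩
      · simp [mem_blockings] at hC
      · simp only [mem_blockings, Finset.mem_filter, consHead] at hC ⊢
        simp only [List.mem_cons, not_or] at hC
        simp [hC.2.2, Ne.symm hC.2.1]
        simpa using hC.1
    · intro C hC C' hC' h
      rcases C with _ | ⟨b, C⟩
      · simp [mem_blockings] at hC
      · rcases C' with _ | ⟨b', C'⟩
        · simp [mem_blockings] at hC'
        · simpa [consHead] using h
    · intro C hC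
      rw [Finset.mem_filter, mem_blockings] at hC
      obtain ⟨⟨h1, h2⟩, h3⟩ := hC
      rcases C with _ | ⟨_ | ⟨z, b⟩, C⟩
      · simp at h1
      · simp at h2
      · simp only [List.flatten_cons, List.cons_append, List.cons.injEq] at h1
        obtain ⟨rfl, h1⟩ := h1
        have hb : b ≠ [] := fun hb => h3 (by simp [hb])
        exact ⟨b :: C, by simpa [mem_blockings, h1, Ne.symm hb] using h2, rfl⟩
    · intros; rfl

end Lists

/-! ### The merging differential -/

section Merge

variable {N : Type*} [AddCommGroup N]

/-- The signed sum of the values of `φ` on the lists obtained from `l` by adding up two neighbouring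
entries, with a last term in which the last entry `x` acts on the value of `φ` by `L x`. The entry
`x` stands for the monomial `u ^ x`, and `τ` for the sign `(-1)^{|u|}`; passing over the entry
`x` contributes the sign `(-1)^{|u ^ x| - 1} = -τ ^ x`. -/
def merge (τ : ℤ) (L : ℕ → N →+ N) : List ℕ → (List ℕ → N) → N
  | [], _ => 0
  | [x], φ => L x (φ [])
  | x :: y :: l, φ =>
    τ ^ x • φ ((x + y) :: l) - τ ^ x • merge τ L (y :: l) (fun l' => φ (x :: l'))

variable {τ : ℤ} {L : ℕ → N →+ N}

theorem merge_nil (φ : List ℕ → N) : merge τ L [] φ = 0 := by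
  rw [merge]

theorem merge_singleton (x : ℕ) (φ : List ℕ → N) : merge τ L [x] φ = L x (φ []) := by
  rw [merge]

theorem merge_cons_cons (x y : ℕ) (l : List ℕ) (φ : List ℕ → N) :
    merge τ L (x :: y :: l) φ =
      τ ^ x • φ ((x + y) :: l) - τ ^ x • merge τ L (y :: l) (fun l' => φ (x :: l')) := by
  rw [merge]

theorem merge_add (l : List ℕ) (φ ψ : List ℕ → N) :
    merge τ L l (fun l' => φ l' + ψ l') = merge τ L l φ + merge τ L l ψ := by
  induction l generalizing φ ψ with
  | nil => simp [merge_nil]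
  | cons x l ih =>
    rcases l with _ | ⟨y, l⟩
    · simp [merge_singleton]
    · simp only [merge_cons_cons, ih, smul_add]
      abel

theorem merge_map {N' : Type*} [AddCommGroup N'] {L' : ℕ → N' →+ N'} (g : N →+ N')
    (hg : ∀ x v, g (L x v) = L' x (g v)) (l : List ℕ) (φ : List ℕ → N) :
    merge τ L' l (fun l' => g (φ l')) = g (merge τ L l φ) := by
  induction l generalizing φ with
  | nil => simp [merge_nil]
  | cons x l ih =>
    rcases l with _ | ⟨y, l⟩
    · simp [merge_singleton, hg]
    · simp only [merge_cons_cons, ih, map_sub, map_zsmul]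

theorem merge_zero (l : List ℕ) : merge τ L l (fun _ => 0) = 0 := by
  simpa using merge_map (τ := τ) (L := L) (L' := L) (0 : N →+ N) (by simp) l (fun _ => 0)

theorem merge_sub (l : List ℕ) (φ ψ : List ℕ → N) :
    merge τ L l (fun l' => φ l' - ψ l') = merge τ L l φ - merge τ L l ψ := by
  have h := merge_add (τ := τ) (L := L) l φ (fun l' => -ψ l')
  have h' := merge_map (τ := τ) (L := L) (L' := L) (-AddMonoidHom.id N) (by simp) l ψ
  simp only [AddMonoidHom.neg_apply, AddMonoidHom.id_apply] at h'
  rw [h'] at h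
  simpa [sub_eq_add_neg] using h

theorem merge_congr {l : List ℕ} {φ ψ : List ℕ → N}
    (h : ∀ l', l'.length + 1 = l.length → φ l' = ψ l') : merge τ L l φ = merge τ L l ψ := by
  induction l generalizing φ ψ with
  | nil => simp [merge_nil]
  | cons x l ih =>
    rcases l with _ | ⟨y, l⟩
    · simp [merge_singleton, h]
    · rw [merge_cons_cons, merge_cons_cons, h _ (by simp), ih]
      intro l' hl'
      exact h _ (by simpa using hl')

/-- The merging differential squares to zero: this is associativity of addition, and of the
action. -/
theorem merge_merge (hL : ∀ x y v, L x (L y v) = L (y + x) v) (l : List ℕ) (φ : List ℕ → N) :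
    merge τ L l (fun l' => merge τ L l' φ) = 0 := by
  induction l generalizing φ with
  | nil => rw [merge_nil]
  | cons x l ih =>
    rcases l with _ | ⟨y, l⟩
    · rw [merge_singleton, merge_nil, map_zero]
    · -- The two summands of the inner differential: `x` is merged with its neighbour, or not.
      have key : merge τ L (y :: l) (fun l' => merge τ L (x :: l') φ) =
          merge τ L ((x + y) :: l) φ := by
        rcases l with _ | ⟨z, l⟩
        · simp [merge_singleton, hL]
        · have h1 : merge τ L (y :: z :: l) (fun l' => merge τ L (x :: l') φ) =
            merge τ L (y :: z :: l) (fun l' =>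
              τ ^ x • φ ((x + l'.headI) :: l'.tail) -
                τ ^ x • merge τ L l' (fun l'' => φ (x :: l''))) := by
            refine merge_congr fun l' hl' => ?_
            rcases l' with _ | ⟨w, l'⟩
            · simp at hl'
            · rw [merge_cons_cons]; rfl
          have h2 : ∀ ψ : List ℕ → N, merge τ L (y :: z :: l) (fun l' => τ ^ x • ψ l') =
              τ ^ x • merge τ L (y :: z :: l) ψ := fun ψ =>
            merge_map (τ := τ) (L := L) (L' := L) (zsmulAddGroupHom (τ ^ x))
              (by simp) _ ψ
          rw [h1, merge_sub, h2, h2, ih, smul_zero, sub_zero, merge_cons_cons, merge_cons_cons,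
            smul_sub, smul_smul, smul_smul, ← pow_add]
          simp [add_assoc]
      rw [merge_cons_cons, key, sub_self]

/-- The sign `(-1)^{|u^{x_1}| + ⋯ + |u^{x_n}| - n}` of a list of exponents. -/
def eps (τ : ℤ) (l : List ℕ) : ℤ := (l.map fun x => -τ ^ x).prod

theorem eps_nil : eps τ [] = 1 := rfl

theorem eps_cons (x : ℕ) (l : List ℕ) : eps τ (x :: l) = -τ ^ x * eps τ l := by
  simp [eps]

theorem eps_append (l l' : List ℕ) : eps τ (l ++ l') = eps τ l * eps τ l' := by
  simp [eps]

theorem merge_append_singleton (l : List ℕ) (x : ℕ) (φ : List ℕ → N) :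
    merge τ L (l ++ [x]) φ = merge τ 0 (l ++ [x]) φ + eps τ l • L x (φ l) := by
  induction l generalizing φ with
  | nil => simp [merge_singleton, eps_nil]
  | cons y l ih =>
    obtain ⟨z, l', hl⟩ : ∃ z l', l ++ [x] = z :: l' := List.exists_cons_of_ne_nil (by simp)
    have h := ih fun l' => φ (y :: l')
    rw [hl] at h
    rw [List.cons_append, hl, merge_cons_cons, merge_cons_cons, h, eps_cons]
    simp only [smul_add, neg_mul, neg_smul, mul_smul]
    abel

/-- The contribution of a splitting `(P, Q, R)` to the merging differential: it is nonzero only if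
`Q` consists of two entries. -/
def mergeAt (τ : ℤ) (φ : List ℕ → N) (P Q R : List ℕ) : N :=
  match Q with
  | [x, y] => τ ^ x • φ (P ++ (x + y) :: R)
  | _ => 0

theorem mergeAt_of_length_ne {φ : List ℕ → N} {P Q R : List ℕ} (h : Q.length ≠ 2) :
    mergeAt τ φ P Q R = 0 := by
  unfold mergeAt
  split
  · simp at h
  · rfl

theorem sum_mergeAt (l : List ℕ) (φ : List ℕ → N) :
    ∑ t ∈ splits l, eps τ t.1 • mergeAt τ φ t.1 t.2.1 t.2.2 = merge τ 0 l φ := by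
  induction l generalizing φ with
  | nil =>
    rw [sum_splits_nil (fun P Q R => eps τ P • mergeAt τ φ P Q R), merge_nil,
      mergeAt_of_length_ne (by simp), smul_zero]
  | cons x l ih =>
    rw [sum_splits_cons x l (fun P Q R => eps τ P • mergeAt τ φ P Q R)]
    have h2 : ∑ t ∈ splits l, eps τ (x :: t.1) • mergeAt τ φ (x :: t.1) t.2.1 t.2.2 =
        -(τ ^ x • merge τ 0 l (fun l' => φ (x :: l'))) := by
      rw [← ih, Finset.smul_sum, ← Finset.sum_neg_distrib]
      refine Finset.sum_congr rfl fun t _ => ?_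
      rw [eps_cons, neg_mul, neg_smul, mul_smul]
      rfl
    rw [h2]
    rcases l with _ | ⟨y, l⟩
    · rw [merge_nil, merge_singleton, Finset.sum_eq_zero]
      · simp
      · rintro ⟨P, Q, R⟩ ht
        simp only [Finset.mem_filter, mem_splits] at ht
        obtain ⟨ht, rfl⟩ := ht
        have := congrArg List.length ht
        simp at this
        rw [mergeAt_of_length_ne, smul_zero]
        show Q.length ≠ 2
        omega
    · rw [merge_cons_cons, sub_eq_add_neg, Finset.sum_eq_single ([], [x, y], l)]
      · simp [mergeAt, eps_nil]
      · rintro ⟨P, Q, R⟩ ht hne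
        simp only [Finset.mem_filter, mem_splits] at ht
        obtain ⟨ht, rfl⟩ := ht
        rw [mergeAt_of_length_ne, smul_zero]
        intro hQ
        obtain ⟨a, b, hab⟩ := List.length_eq_two.1 hQ
        simp only at hab
        subst hab
        simp only [List.nil_append, List.cons_append, List.cons.injEq] at ht
        obtain ⟨rfl, rfl, rfl⟩ := ht
        simp at hne
      · intro h
        simp [mem_splits] at h

/-- The contribution of a splitting `(P, Q, R)` of a block decomposition to the derivation that merges
two neighbouring entries of the same block: it is nonzero only if `Q` is a single block. -/
def mergeBlockAt (τ : ℤ) (ψ : List (List ℕ) → N) (P Q R : List (List ℕ)) : N :=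
  match Q with
  | [b] => merge τ 0 b (fun b' => ψ (P ++ b' :: R))
  | _ => 0

theorem mergeBlockAt_of_length_ne {ψ : List (List ℕ) → N} {P Q R : List (List ℕ)}
    (h : Q.length ≠ 1) : mergeBlockAt τ ψ P Q R = 0 := by
  unfold mergeBlockAt
  split
  · simp at h
  · rfl

/-- The signed sum of the values of `ψ` on the block decompositions obtained from `C` by merging two
neighbouring entries of the same block. -/
def mergeBlocks (τ : ℤ) (ψ : List (List ℕ) → N) (C : List (List ℕ)) : N :=
  ∑ t ∈ splits C, eps τ t.1.flatten • mergeBlockAt τ ψ t.1 t.2.1 t.2.2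

theorem mergeBlocks_nil (ψ : List (List ℕ) → N) : mergeBlocks τ ψ [] = 0 := by
  rw [mergeBlocks, sum_splits_nil (fun P Q R => eps τ P.flatten • mergeBlockAt τ ψ P Q R),
    mergeBlockAt_of_length_ne (by simp), smul_zero]

theorem mergeBlocks_cons (ψ : List (List ℕ) → N) (b : List ℕ) (C : List (List ℕ)) :
    mergeBlocks τ ψ (b :: C) = merge τ 0 b (fun b' => ψ (b' :: C)) +
      eps τ b • mergeBlocks τ (fun C' => ψ (b :: C')) C := by
  rw [mergeBlocks, sum_splits_cons b C (fun P Q R => eps τ P.flatten • mergeBlockAt τ ψ P Q R)]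
  congr 1
  · rw [Finset.sum_eq_single ([], [b], C)]
    · simp [mergeBlockAt, eps_nil]
    · rintro ⟨P, Q, R⟩ ht hne
      simp only [Finset.mem_filter, mem_splits] at ht
      obtain ⟨ht, rfl⟩ := ht
      rw [mergeBlockAt_of_length_ne, smul_zero]
      intro hQ
      obtain ⟨a, ha⟩ := List.length_eq_one_iff.1 hQ
      simp only at ha
      subst ha
      simp only [List.nil_append, List.cons_append, List.cons.injEq] at ht
      obtain ⟨rfl, rfl⟩ := ht
      simp at hne
    · intro h
      simp [mem_splits] at h
  · rw [mergeBlocks, Finset.smul_sum]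
    refine Finset.sum_congr rfl fun t _ => ?_
    rw [List.flatten_cons, eps_append, mul_smul]
    rfl

theorem sum_blockings_add_cons (x y : ℕ) (l : List ℕ) (ψ : List (List ℕ) → N) :
    ∑ C ∈ blockings ((x + y) :: l), ψ C =
      ∑ C ∈ blockings (y :: l), ψ (match C with
        | (z :: b) :: C' => ((x + z) :: b) :: C'
        | C => C) := by
  rcases l with _ | ⟨z, l⟩
  · rw [sum_blockings_singleton, sum_blockings_singleton]
  · rw [sum_blockings_cons_cons, sum_blockings_cons_cons]
    refine congrArg₂ (· + ·) rfl (Finset.sum_congr rfl fun C hC => ?_)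
    rcases C with _ | ⟨b, C⟩
    · simp [mem_blockings] at hC
    · rfl

/-- Merging two entries of a list and then decomposing it into blocks amounts to decomposing the list
into blocks and then merging two entries of the same block. -/
theorem merge_sum_blockings (l : List ℕ) (ψ : List (List ℕ) → N) :
    merge τ 0 l (fun l' => ∑ C ∈ blockings l', ψ C) =
      ∑ C ∈ blockings l, mergeBlocks τ ψ C := by
  induction l generalizing ψ with
  | nil => rw [merge_nil, sum_blockings_nil, mergeBlocks_nil]
  | cons x l ih =>
    rcases l with _ | ⟨y, l⟩
    · rw [merge_singleton, sum_blockings_singleton, mergeBlocks_cons, merge_singleton,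
        mergeBlocks_nil]
      simp
    · have h1 : merge τ 0 (y :: l) (fun l' => ∑ C ∈ blockings (x :: l'), ψ C) =
          ∑ C ∈ blockings (y :: l), mergeBlocks τ (fun C' => ψ ([x] :: C')) C +
          ∑ C ∈ blockings (y :: l), mergeBlocks τ (fun C' => ψ (consHead x C')) C := by
        rcases l with _ | ⟨z, l⟩
        · simp [sum_blockings_singleton, merge_singleton, mergeBlocks_cons, mergeBlocks_nil]
        · rw [← ih, ← ih, ← merge_add]
          refine merge_congr fun l' hl' => ?_
          rcases l' with _ | ⟨w, l'⟩
          · simp at hl'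
          · rw [sum_blockings_cons_cons]
      rw [merge_cons_cons, h1, sum_blockings_cons_cons, sum_blockings_add_cons, Finset.smul_sum,
        smul_add, Finset.smul_sum, Finset.smul_sum, sub_eq_add_neg, neg_add, add_left_comm,
        ← Finset.sum_neg_distrib, ← Finset.sum_neg_distrib, ← Finset.sum_add_distrib]
      congr 1
      · refine Finset.sum_congr rfl fun C _ => ?_
        rw [mergeBlocks_cons, merge_singleton, eps_cons, eps_nil]
        simp
      · refine Finset.sum_congr rfl fun C hC => ?_
        rw [mem_blockings] at hC
        rcases C with _ | ⟨_ | ⟨z, b⟩, C⟩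
        · simp at hC
        · simp at hC
        · simp only [consHead, mergeBlocks_cons, merge_cons_cons, eps_cons x]
          simp only [smul_add, neg_mul, neg_smul, mul_smul]
          abel

end Merge

/-! ### Multilinear operations on lists -/

section Operations

variable {K : Type*} {G : Type*} {V : Type*} {W : Type*} [Field K] [CommRing G]
    [AddCommGroup V] [Module K V] [AddCommGroup W] [Module K W]

/-- The value of a family of multilinear operations on a list of inputs. -/
def opList (F : ∀ k : ℕ, MultilinearMap K (fun _ : Fin k => V) W) (w : List V) : W :=
  F w.length w.get

variable {F : ∀ k : ℕ, MultilinearMap K (fun _ : Fin k => V) W}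

theorem opList_eq {w : List V} {k : ℕ} {a : Fin k → V} (hk : w.length = k)
    (h : ∀ i : Fin k, a i = w[i]'(by omega)) : F k a = opList F w := by
  subst hk
  exact congrArg _ (funext h)

/-- Substitution of a vector into a slot of a multilinear operation. -/
def opSlot (F : ∀ k : ℕ, MultilinearMap K (fun _ : Fin k => V) W) (P R : List V) : V →ₗ[K] W :=
  (F (P ++ 0 :: R).length).toLinearMap (P ++ 0 :: R).get ⟨P.length, by simp⟩

theorem opSlot_apply (P R : List V) (v : V) : opSlot F P R v = opList F (P ++ v :: R) := by
  refine opList_eq (by simp) fun i => ?_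
  by_cases hi : i = ⟨P.length, by simp⟩
  · subst hi
    simp
  · rw [Function.update_of_ne hi]
    have hi' : (i : ℕ) ≠ P.length := fun h => hi (Fin.ext h)
    simp only [List.get_eq_getElem, Fin.getElem_fin, List.getElem_append, List.getElem_cons]
    split_ifs
    · rfl
    · omega
    · rfl

theorem sum_range_eq_sum_take {ι : Type*} {C : List ι} {deg : ι → G} {g : ℕ → G}
    (hg : ∀ i (h : i < C.length), g i = deg C[i]) {n : ℕ} (hn : n ≤ C.length) :
    ∑ i ∈ Finset.range n, (g i - 1) = ((C.take n).map fun x => deg x - 1).sum := by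
  induction n with
  | zero => simp
  | succ n ih =>
    rw [Finset.sum_range_succ, ih (by omega), hg n (by omega),
      ← List.take_append_getElem (by omega : n < C.length), List.map_append, List.sum_append]
    simp

/-- The sum over insertions of one operation into another, in terms of splittings of the list of
inputs. -/
theorem insertionSum_eq {ι : Type*} [DecidableEq ι] {par : G →+* ZMod 2}
    {μ : ∀ k : ℕ, MultilinearMap K (fun _ : Fin k => V) V}
    (C : List ι) (v : ι → V) (deg : ι → G) {g : ℕ → G} {a : ℕ → V}
    (hg : ∀ i (h : i < C.length), g i = deg C[i]) (ha : ∀ i (h : i < C.length), a i = v C[i]) :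
    insertionSum par μ F g a C.length =
      ∑ t ∈ splits C, sgn (par (t.1.map fun x => deg x - 1).sum) •
        opList F (t.1.map v ++ opList μ (t.2.1.map v) :: t.2.2.map v) := by
  rw [sum_splits C (fun P Q R => sgn (par (P.map fun x => deg x - 1).sum) •
    opList F (P.map v ++ opList μ (Q.map v) :: R.map v)), insertionSum]
  refine Finset.sum_congr rfl fun t ht => ?_
  rw [Finset.Nat.mem_antidiagonalTuple, Fin.sum_univ_three] at ht
  rw [insertionTerm, maltese, sum_range_eq_sum_take hg (by omega)]
  congr 1
  have hμ : μ (t 1) (fun j => a (t 0 + j)) = opList μ (((C.drop (t 0)).take (t 1)).map v) := by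
    refine opList_eq (by simp; omega) fun i => ?_
    rw [ha _ (by omega)]
    simp
  refine opList_eq (by simp; omega) fun i => ?_
  rw [hμ]
  have hi := i.2
  simp only [replaceAt, Fin.getElem_fin, List.getElem_append, List.getElem_cons, List.length_map,
    List.length_take, List.getElem_map, List.getElem_take, List.getElem_drop, lt_min_iff]
  split_ifs <;> try omega
  · exact ha _ _
  · rfl
  · rw [ha _ (by omega)]
    congr 2
    omega

end Operations

section Relations

variable {K : Type*} {G : Type*} {V : Type*} [Field K] [CommRing G] [DecidableEq G]
  [AddCommGroup V] [Module K V] {par : G →+* ZMod 2}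
  {𝒱 : G → Submodule K V} [DirectSum.Decomposition 𝒱]

/-- The `A_∞`-relations, for the list of homogeneous inputs `C.map v`. -/
theorem AInfAlgebra.relation_list (M : AInfAlgebra par 𝒱) {ι : Type*} [DecidableEq ι] (C : List ι)
    (v : ι → V) (deg : ι → G) (hv : ∀ x, v x ∈ 𝒱 (deg x)) :
    ∑ t ∈ splits C, sgn (par (t.1.map fun x => deg x - 1).sum) •
      opList M.μ (t.1.map v ++ opList M.μ (t.2.1.map v) :: t.2.2.map v) = 0 := by
  rw [← insertionSum_eq (g := fun i => if h : i < C.length then deg C[i] else 0)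
    (a := fun i => if h : i < C.length then v C[i] else 0) C v deg
    (fun i h => by simp [h]) (fun i h => by simp [h])]
  refine M.relation _ _ _ fun i => ?_
  split_ifs
  · exact hv _
  · exact zero_mem _

theorem AInfAlgebra.opList_mem (M : AInfAlgebra par 𝒱) {ι : Type*} (C : List ι)
    (v : ι → V) (deg : ι → G) (hv : ∀ x, v x ∈ 𝒱 (deg x)) :
    opList M.μ (C.map v) ∈ 𝒱 ((C.map fun x => deg x - 1).sum + 2) := by
  have h := M.μ_mem C.length (fun i => deg C[i]) (fun i => v C[i]) (fun i => hv _)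
  rw [opList_eq (w := C.map v) (by simp) (fun i => by simp)] at h
  convert h using 2
  have : ∀ C : List ι, (C.map fun x => deg x - 1).sum = ∑ i : Fin C.length, deg C[i] - C.length := by
    intro C
    induction C with
    | nil => simp
    | cons x C ih =>
      rw [List.map_cons, List.sum_cons, ih]
      simp [Fin.sum_univ_succ]
      ring
  rw [this]
  ring

theorem AInfAlgebra.opList_singleton (M : AInfAlgebra par 𝒱) (v : V) :
    opList M.μ [v] = M.d v := by
  rw [M.d_apply]
  exact (opList_eq rfl fun i => by simp).symm

theorem AInfAlgebra.opList_nil (M : AInfAlgebra par 𝒱) : opList M.μ [] = 0 := by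
  change M.μ 0 _ = 0
  rw [M.μ_zero]
  rfl

/-- On homogeneous inputs, `μ² (y, x) = (-1)^{|x|} y x`. -/
theorem AInfAlgebra.opList_pair (M : AInfAlgebra par 𝒱) {g : G} {x : V} (hx : x ∈ 𝒱 g) (y : V) :
    opList M.μ [x, y] = sgn (par g) • M.mul y x := by
  have h : M.mul y (signMap par 𝒱 x) = opList M.μ [x, y] := by
    rw [M.mul_apply, AInfAlgebra.signMap_signMap]
    exact opList_eq rfl fun i => by fin_cases i <;> rfl
  rw [← h, signMap_of_mem hx, map_zsmul]

end Relations

/-! ### Hochschild cohomology of the polynomial algebra -/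

section Hochschild

variable {K : Type*} [Field K]

open Polynomial

/-- The action of the exponents on `K[u]` by multiplication. -/
noncomputable def mulPow (K : Type*) [Field K] (x : ℕ) : K[X] →+ K[X] :=
  AddMonoidHom.mulLeft (X ^ x)

theorem mulPow_apply (x : ℕ) (p : K[X]) : mulPow K x p = X ^ x * p := rfl

variable {τ : ℤ}

theorem merge_mul (l : List ℕ) (q : K[X]) (φ : List ℕ → K[X]) :
    merge τ (mulPow K) l (fun l' => q * φ l') = q * merge τ (mulPow K) l φ :=
  merge_map (AddMonoidHom.mulLeft q) (fun x v => by simp [mulPow_apply, mul_left_comm]) l φ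

theorem merge_zsmul (l : List ℕ) (n : ℤ) (φ : List ℕ → K[X]) :
    merge τ (mulPow K) l (fun l' => n • φ l') = n • merge τ (mulPow K) l φ :=
  merge_map (zsmulAddGroupHom n) (fun x v => by simp [mulPow_apply, mul_left_comm]) l φ

/-- The Hochschild coboundary of an even cochain on the monomials of `K[u]`, that is, of a cochain with
the degrees of the components of an `A_∞`-homomorphism, `ψ l` being of degree `rdeg δ l + 1`. -/
noncomputable def coboundary (τ : ℤ) (ψ : List ℕ → K[X]) : List ℕ → K[X]
  | [] => 0
  | x :: l => τ ^ x • (X ^ x * ψ l) - merge τ (mulPow K) (x :: l) ψ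

/-- The Hochschild cocycle condition at `x :: l` for an odd cochain on the monomials of `K[u]`, that is,
for a cochain with the degrees of the obstructions, `φ l` being of degree `rdeg δ l + 2`. The
parity accounts for the sign `τ ^ x` that is absent here but present in `coboundary`. -/
def CocycleAt (τ : ℤ) (φ : List ℕ → K[X]) (x : ℕ) (l : List ℕ) : Prop :=
  X ^ x * φ l = merge τ (mulPow K) (x :: l) φ

theorem cocycleAt_coboundary (hτ : τ * τ = 1) (ψ : List ℕ → K[X]) (x y : ℕ) (l : List ℕ) :
    CocycleAt τ (coboundary τ ψ) x (y :: l) := by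
  have hsq : ∀ z, τ ^ z * τ ^ z = 1 := fun z => by rw [← mul_pow, hτ, one_pow]
  have h : merge τ (mulPow K) (x :: y :: l) (coboundary τ ψ) =
      merge τ (mulPow K) (x :: y :: l) (fun l' => τ ^ l'.headI • (X ^ l'.headI * ψ l'.tail)) := by
    symm
    rw [← sub_zero (merge τ (mulPow K) (x :: y :: l) (fun l' => _)),
      ← merge_merge (τ := τ) (L := mulPow K) (fun a b v => ?_) (x :: y :: l) ψ, ← merge_sub]
    · refine merge_congr fun l' hl' => ?_
      rcases l' with _ | ⟨z, l'⟩
      · simp at hl'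
      · rfl
    · simp only [mulPow_apply, pow_add]
      ring
  rw [CocycleAt, h, merge_cons_cons]
  simp only [List.headI, List.tail, coboundary]
  rw [merge_zsmul, merge_mul, smul_smul, smul_smul, pow_add τ x y, ← mul_assoc, hsq, one_mul,
    one_smul, pow_add, mul_sub, mul_smul_comm, mul_assoc]

/-- A primitive of a cocycle `φ`: the cochain `ψ` on the lists with a given tail. Its values on lists
that begin with `0` or `1` come from inserting the unit; its other values are forced by the
equation that `φ` is the coboundary of `ψ`, on lists that begin with `1`. -/
noncomputable def primitiveAux (τ : ℤ) (φ : List ℕ → K[X]) (l : List ℕ) : ℕ → K[X]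
  | 0 => φ (0 :: 0 :: l)
  | 1 => -(τ • φ (1 :: 0 :: l))
  | y + 2 => X * primitiveAux τ φ l (y + 1) +
      merge τ (mulPow K) ((y + 1) :: l) (fun l' => -(τ • φ (1 :: 0 :: l'))) -
      τ • φ (1 :: (y + 1) :: l)

/-- A primitive of a cocycle. -/
noncomputable def primitive (τ : ℤ) (φ : List ℕ → K[X]) : List ℕ → K[X]
  | [] => 0
  | x :: l => primitiveAux τ φ l x

/-- Hochschild cocycles of `K[u]` in degrees at least two are coboundaries. -/
theorem coboundary_primitive (hτ : τ * τ = 1) (φ : List ℕ → K[X])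
    (hφ : ∀ x y z l, CocycleAt τ φ x (y :: z :: l)) (x y : ℕ) (l : List ℕ) :
    φ (x :: y :: l) = coboundary τ (primitive τ φ) (x :: y :: l) := by
  have hττ : ∀ p : K[X], τ • τ • p = p := fun p => by rw [smul_smul, hτ, one_smul]
  -- If `0` is the first entry, the unit can be inserted.
  have h0 : ∀ y l, φ (0 :: y :: l) = coboundary τ (primitive τ φ) (0 :: y :: l) := by
    intro y l
    have h := hφ 0 0 y l
    rw [CocycleAt, merge_cons_cons, merge_cons_cons] at h
    rw [coboundary, merge_cons_cons]
    simp only [pow_zero, one_mul, one_smul, zero_add] at h ⊢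
    have h' := sub_eq_zero.2 (sub_eq_self.1 h.symm)
    simp only [sub_zero] at h'
    rw [sub_sub_cancel, sub_eq_zero.1 h']
    rfl
  have h10 : ∀ y l, φ (1 :: 0 :: y :: l) = coboundary τ (primitive τ φ) (1 :: 0 :: y :: l) := by
    intro y l
    have h := hφ 1 0 0 (y :: l)
    rw [CocycleAt, merge_cons_cons, merge_cons_cons, merge_cons_cons] at h
    rw [coboundary, merge_cons_cons, merge_cons_cons]
    simp only [pow_zero, pow_one, one_smul, zero_add, add_zero, primitive,
      primitiveAux] at h ⊢
    have e : merge τ (mulPow K) (y :: l) (fun l' => -(τ • φ (1 :: 0 :: 0 :: l'))) =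
        -(τ • merge τ (mulPow K) (y :: l) (fun l' => φ (1 :: 0 :: 0 :: l'))) := by
      simpa using merge_zsmul (τ := τ) (y :: l) (-τ) (fun l' => φ (1 :: 0 :: 0 :: l'))
    rw [e, h]
    simp only [smul_sub, smul_neg, hττ]
    abel
  have h10' : ∀ l, φ (1 :: 0 :: l) = coboundary τ (primitive τ φ) (1 :: 0 :: l) := by
    rintro (_ | ⟨y, l⟩)
    · have h := hφ 1 0 0 []
      rw [CocycleAt, merge_cons_cons, merge_cons_cons, merge_singleton] at h
      rw [coboundary, merge_cons_cons, merge_singleton]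
      simp only [pow_zero, pow_one, one_mul, one_smul, add_zero, primitive,
        primitiveAux, mulPow_apply] at h ⊢
      rw [h]
      simp only [smul_sub, smul_neg, hττ]
      abel
    · exact h10 y l
  have h1 : ∀ y l, φ (1 :: y :: l) = coboundary τ (primitive τ φ) (1 :: y :: l) := by
    rintro (_ | y) l
    · exact h10' l
    · rw [coboundary, merge_cons_cons]
      simp only [pow_one, add_comm 1 (y + 1), primitive, primitiveAux]
      simp only [smul_sub, smul_add, hττ]
      abel
  -- The difference is a cocycle that vanishes on lists beginning with `0` or `1`.
  induction x generalizing y l with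
  | zero => exact h0 y l
  | succ x ih =>
    have h := hφ 1 x y l
    have h' := cocycleAt_coboundary hτ (primitive τ φ) 1 x (y :: l)
    rw [CocycleAt, merge_cons_cons] at h h'
    rw [← ih, h] at h'
    have e : merge τ (mulPow K) (x :: y :: l) (fun l' => φ (1 :: l')) =
        merge τ (mulPow K) (x :: y :: l)
          (fun l' => coboundary τ (primitive τ φ) (1 :: l')) := by
      refine merge_congr fun l' hl' => ?_
      rcases l' with _ | ⟨z, l'⟩
      · simp at hl'
      · exact h1 z l'
    rw [e, pow_one, sub_left_inj, add_comm 1 x] at h'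
    rw [← hττ (φ _), h', hττ]

end Hochschild

/-! ### Degrees -/

section Degrees

open Polynomial

variable {G : Type*} [CommRing G]

/-- The reduced degree `|u^{x_1}| + ⋯ + |u^{x_n}| - n` of a list of exponents, if `u` has
degree `δ`. -/
def rdeg (δ : G) (l : List ℕ) : G := (l.map fun x : ℕ => (x : G) * δ - 1).sum

variable {δ : G}

theorem rdeg_nil : rdeg δ [] = 0 := rfl

theorem rdeg_cons (x : ℕ) (l : List ℕ) : rdeg δ (x :: l) = (x : G) * δ - 1 + rdeg δ l := by
  simp [rdeg]

theorem rdeg_append (l l' : List ℕ) : rdeg δ (l ++ l') = rdeg δ l + rdeg δ l' := by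
  simp [rdeg]

theorem rdeg_flatten (C : List (List ℕ)) : rdeg δ C.flatten = (C.map (rdeg δ)).sum := by
  induction C with
  | nil => rfl
  | cons b C ih => rw [List.flatten_cons, rdeg_append, ih, List.map_cons, List.sum_cons]

theorem sgn_par_natCast_mul (par : G →+* ZMod 2) (δ : G) (x : ℕ) :
    sgn (par ((x : G) * δ)) = sgn (par δ) ^ x := by
  induction x with
  | zero => simp [sgn_zero]
  | succ x ih => rw [Nat.cast_succ, add_mul, one_mul, map_add, sgn_add, ih, pow_succ]

theorem sgn_par_rdeg (par : G →+* ZMod 2) (δ : G) (l : List ℕ) :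
    sgn (par (rdeg δ l)) = eps (sgn (par δ)) l := by
  induction l with
  | nil => simp [rdeg_nil, sgn_zero, eps_nil]
  | cons x l ih =>
    rw [rdeg_cons, map_add, sgn_add, ih, map_sub, map_one, sgn_sub_one, sgn_par_natCast_mul, eps_cons]

/-- The merging differential raises the degree by one. -/
theorem merge_mem_degree {N : Type*} [AddCommGroup N] {S : Type*} [SetLike S N]
    [AddSubgroupClass S N] {τ : ℤ} {L : ℕ → N →+ N} (𝒩 : G → S)
    (hL : ∀ (x : ℕ) (g : G), ∀ v ∈ 𝒩 g, L x v ∈ 𝒩 (x * δ + g)) {l : List ℕ} {φ : List ℕ → N} {c : G}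
    (h : ∀ l', φ l' ∈ 𝒩 (rdeg δ l' + c)) : merge τ L l φ ∈ 𝒩 (rdeg δ l + (c + 1)) := by
  induction l generalizing φ c with
  | nil => rw [merge_nil]; exact zero_mem _
  | cons x l ih =>
    rcases l with _ | ⟨y, l⟩
    · rw [merge_singleton]
      convert hL x _ _ (h []) using 2
      simp only [rdeg_cons, rdeg_nil]
      ring
    · rw [merge_cons_cons]
      refine sub_mem (zsmul_mem ?_ _) (zsmul_mem ?_ _)
      · convert h ((x + y) :: l) using 2
        simp only [rdeg_cons]
        push_cast
        ring
      · convert ih (φ := fun l' => φ (x :: l')) (c := x * δ - 1 + c) (fun l' => ?_) using 2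
        · simp only [rdeg_cons]
          ring
        · convert h (x :: l') using 2
          simp only [rdeg_cons]
          ring

variable {K : Type*} [Field K] {τ : ℤ}

theorem X_pow_mul_mem [DecidableEq G] (x : ℕ) (g : G) (p : K[X])
    (hp : p ∈ polynomialGrading K δ g) :
    X ^ x * p ∈ polynomialGrading K δ (x * δ + g) :=
  SetLike.mul_mem_graded (Submodule.subset_span ⟨x, rfl, rfl⟩) hp

theorem primitive_mem [DecidableEq G] {φ : List ℕ → K[X]}
    (hφ : ∀ l, φ l ∈ polynomialGrading K δ (rdeg δ l + 2)) (l : List ℕ) :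
    primitive τ φ l ∈ polynomialGrading K δ (rdeg δ l + 1) := by
  rcases l with _ | ⟨x, l⟩
  · exact zero_mem _
  have h1 : ∀ l, -(τ • φ (1 :: 0 :: l)) ∈ polynomialGrading K δ (rdeg δ l + δ) := by
    intro l
    refine neg_mem (zsmul_mem ?_ _)
    convert hφ (1 :: 0 :: l) using 2
    simp only [rdeg_cons]
    push_cast
    ring
  rw [primitive]
  induction x using Nat.strong_induction_on with
  | _ x ih =>
    match x with
    | 0 =>
      rw [primitiveAux]
      convert hφ (0 :: 0 :: l) using 2
      simp only [rdeg_cons]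
      push_cast
      ring
    | 1 =>
      rw [primitiveAux]
      convert h1 l using 2
      simp only [rdeg_cons]
      push_cast
      ring
    | x + 2 =>
      rw [primitiveAux]
      refine sub_mem (add_mem ?_ ?_) (zsmul_mem ?_ _)
      · convert X_pow_mul_mem 1 _ _ (ih (x + 1) (by omega)) using 2
        · simp only [rdeg_cons]
          push_cast
          ring
        · rw [pow_one]
      · convert merge_mem_degree (L := mulPow K) (polynomialGrading K δ)
          (fun x g p hp => X_pow_mul_mem x g p hp) h1 using 2
        simp only [rdeg_cons]
        push_cast
        ring
      · convert hφ (1 :: (x + 1) :: l) using 2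
        simp only [rdeg_cons]
        push_cast
        ring

end Degrees

/-! ### Cocycles representing the elements of a graded algebra -/

section Represents

variable {K : Type*} {G : Type*} {V : Type*} [Field K] [CommRing G] [DecidableEq G]
  [AddCommGroup V] [Module K V] {par : G →+* ZMod 2}
  {𝒱 : G → Submodule K V} [DirectSum.Decomposition 𝒱] {M : AInfAlgebra par 𝒱}
  {A : Type*} [Ring A] [Algebra K A] {𝒜 : G → Submodule K A}

namespace AInfAlgebra.CohomologyIso

variable (e : M.CohomologyIso 𝒜)

/-- The element `z` is a cocycle, whose class corresponds to `p` under the isomorphism `e` of `A` with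
the cohomology. -/
def Represents (z : V) (p : A) : Prop :=
  ∃ h : z ∈ LinearMap.ker M.d, e.toEquiv p = M.coboundaries.mkQ ⟨z, h⟩

variable {e}

theorem Represents.d_eq_zero {z : V} {p : A} (h : e.Represents z p) : M.d z = 0 := h.1

theorem Represents.unique {z : V} {p q : A} (hp : e.Represents z p) (hq : e.Represents z q) :
    p = q := by
  obtain ⟨h, hp⟩ := hp
  obtain ⟨h', hq⟩ := hq
  exact e.toEquiv.injective (hp.trans hq.symm)

theorem Represents.add {z w : V} {p q : A} (hz : e.Represents z p) (hw : e.Represents w q) :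
    e.Represents (z + w) (p + q) := by
  obtain ⟨h, hz⟩ := hz
  obtain ⟨h', hw⟩ := hw
  exact ⟨add_mem h h', by rw [map_add, hz, hw, ← map_add]; rfl⟩

theorem Represents.zsmul {z : V} {p : A} (hz : e.Represents z p) (n : ℤ) :
    e.Represents (n • z) (n • p) := by
  obtain ⟨h, hz⟩ := hz
  exact ⟨zsmul_mem h n, by rw [map_zsmul, hz, ← map_zsmul]; rfl⟩

theorem Represents.smul {z : V} {p : A} (hz : e.Represents z p) (c : K) :
    e.Represents (c • z) (c • p) := by
  obtain ⟨h, hz⟩ := hz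
  exact ⟨Submodule.smul_mem _ c h, by rw [map_smul, hz, ← map_smul]; rfl⟩

theorem Represents.sub {z w : V} {p q : A} (hz : e.Represents z p) (hw : e.Represents w q) :
    e.Represents (z - w) (p - q) := by
  simpa [sub_eq_add_neg] using hz.add (hw.zsmul (-1))

theorem Represents.mul {z w : V} {p q : A} (hz : e.Represents z p) (hw : e.Represents w q) :
    e.Represents (M.mul z w) (p * q) := by
  obtain ⟨h, hz⟩ := hz
  obtain ⟨h', hw⟩ := hw
  have hzw := (M.cocycleMul (⟨z, h⟩ : LinearMap.ker M.d) ⟨w, h'⟩).2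
  exact ⟨hzw, by rw [e.map_mul, hz, hw]; rfl⟩

theorem represents_d (y : V) : e.Represents (M.d y) 0 := by
  refine ⟨M.d_d y, ?_⟩
  have h : (⟨M.d y, M.d_d y⟩ : LinearMap.ker M.d) ∈ M.coboundaries := ⟨y, rfl⟩
  rw [map_zero]
  exact ((Submodule.Quotient.mk_eq_zero _).2 h).symm

theorem represents_zero : e.Represents (0 : V) 0 := by
  simpa using represents_d (e := e) 0

theorem Represents.opList_pair {z w : V} {p q : A} {g : G} (hz : e.Represents z p)
    (hw : e.Represents w q) (hg : z ∈ 𝒱 g) :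
    e.Represents (opList M.μ [z, w]) (sgn (par g) • (q * p)) := by
  rw [M.opList_pair hg]
  exact (hw.mul hz).zsmul _

theorem represents_merge {τ : ℤ} {l : List ℕ} {D : List ℕ → V} {φ : List ℕ → A}
    (h : ∀ l', l'.length + 1 = l.length → e.Represents (D l') (φ l')) :
    e.Represents (merge τ 0 l D) (merge τ 0 l φ) := by
  induction l generalizing D φ with
  | nil => simpa [merge_nil] using represents_zero
  | cons x l ih =>
    rcases l with _ | ⟨y, l⟩
    · simpa [merge_singleton] using represents_zero
    · rw [merge_cons_cons, merge_cons_cons]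
      exact ((h _ (by simp)).zsmul _).sub
        ((ih fun l' hl' => h _ (by simpa using hl')).zsmul _)

theorem exists_represents_of_mem {g : G} {p : A} (hp : p ∈ 𝒜 g) : ∃ z ∈ 𝒱 g, e.Represents z p := by
  have h : e.toEquiv p ∈ M.cohomologyGrading g := by
    rw [← e.map_grading]
    exact ⟨p, hp, rfl⟩
  obtain ⟨⟨z, hz⟩, hzg, h⟩ := h
  exact ⟨z, hzg, hz, h.symm⟩

theorem exists_of_cocycle_mem {g : G} {z : V} (hz : z ∈ 𝒱 g) (hd : M.d z = 0) :
    ∃ p ∈ 𝒜 g, e.Represents z p := by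
  have h : M.coboundaries.mkQ ⟨z, hd⟩ ∈ M.cohomologyGrading g := ⟨⟨z, hd⟩, hz, rfl⟩
  rw [← e.map_grading] at h
  obtain ⟨p, hp, h⟩ := h
  exact ⟨p, hp, hd, h⟩

/-- A homogeneous cocycle that represents zero has a homogeneous primitive. -/
theorem Represents.exists_primitive {g : G} {z : V} (h : e.Represents z 0) (hz : z ∈ 𝒱 (g + 1)) :
    ∃ y ∈ 𝒱 g, M.d y = z := by
  obtain ⟨hk, h⟩ := h
  rw [map_zero] at h
  obtain ⟨y, hy⟩ := (Submodule.Quotient.mk_eq_zero _).1 h.symm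
  have hy' : M.d y = z := hy
  refine ⟨DirectSum.decompose 𝒱 y g, SetLike.coe_mem _, ?_⟩
  have key : ∀ y : V, M.d (DirectSum.decompose 𝒱 y g) = DirectSum.decompose 𝒱 (M.d y) (g + 1) := by
    intro y
    induction y using DirectSum.Decomposition.inductionOn 𝒱 with
    | zero => simp
    | add a b ha hb => simp [ha, hb, DirectSum.decompose_add]
    | homogeneous x =>
      rename_i i
      by_cases hi : i = g
      · subst hi
        rw [DirectSum.decompose_of_mem_same 𝒱 x.2,
          DirectSum.decompose_of_mem_same 𝒱 (M.d_mem x.2)]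
      · rw [DirectSum.decompose_of_mem_ne 𝒱 x.2 hi, map_zero,
          DirectSum.decompose_of_mem_ne 𝒱 (M.d_mem x.2) (by simpa using hi)]
  rw [key, hy', DirectSum.decompose_of_mem_same 𝒱 hz]

end AInfAlgebra.CohomologyIso

end Represents

/-! ### The defect of a family of maps on monomials -/

section Defect

variable {K : Type*} {G : Type*} {V : Type*} [Field K] [CommRing G] [DecidableEq G]
  [AddCommGroup V] [Module K V] {par : G →+* ZMod 2}
  {𝒱 : G → Submodule K V} [DirectSum.Decomposition 𝒱] (M : AInfAlgebra par 𝒱)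

/-- The failure of `f`, seen as the values on monomials of the components of an `A_∞`-homomorphism
from `K[u]` to `M`, to satisfy the equations of an `A_∞`-homomorphism. -/
def defect (τ : ℤ) (f : List ℕ → V) (l : List ℕ) : V :=
  ∑ C ∈ blockings l, opList M.μ (C.map f) - merge τ 0 l f

variable {M} {δ : G} {f : List ℕ → V}

theorem defect_mem {τ : ℤ} (hf : ∀ b, f b ∈ 𝒱 (rdeg δ b + 1)) (l : List ℕ) :
    defect M τ f l ∈ 𝒱 (rdeg δ l + 2) := by
  refine sub_mem (sum_mem fun C hC => ?_) ?_
  · have h := M.opList_mem C f _ hf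
    simp only [add_sub_cancel_right] at h
    rwa [← rdeg_flatten, (mem_blockings.1 hC).1] at h
  · rw [← one_add_one_eq_two]
    exact merge_mem_degree 𝒱 (fun x g v _ => zero_mem _) hf

/-- The equation satisfied by the defect, a consequence of the `A_∞`-relations of `M` and of
the vanishing of the square of the merging differential. -/
theorem defect_equation (hf : ∀ b, f b ∈ 𝒱 (rdeg δ b + 1)) (l : List ℕ) :
    ∑ t ∈ splits l, eps (sgn (par δ)) t.1 • ∑ P ∈ blockings t.1, ∑ R ∈ blockings t.2.2,
      opList M.μ (P.map f ++ defect M (sgn (par δ)) f t.2.1 :: R.map f) +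
        merge (sgn (par δ)) 0 l (defect M (sgn (par δ)) f) = 0 := by
  set τ := sgn (par δ) with hτ
  have hD : ∀ b, ∑ Q ∈ blockings b, opList M.μ (Q.map f) = defect M τ f b + merge τ 0 b f :=
    fun b => by rw [defect, sub_add_cancel]
  have h1 : ∑ C ∈ blockings l, ∑ t ∈ splits C, eps τ t.1.flatten •
      opList M.μ (t.1.map f ++ opList M.μ (t.2.1.map f) :: t.2.2.map f) = 0 := by
    refine Finset.sum_eq_zero fun C _ => ?_
    rw [← M.relation_list C f _ hf]
    refine Finset.sum_congr rfl fun t _ => ?_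
    simp only [add_sub_cancel_right]
    rw [← rdeg_flatten, sgn_par_rdeg]
  rw [sum_blockings_splits l (fun P Q R => eps τ P.flatten •
    opList M.μ (P.map f ++ opList M.μ (Q.map f) :: R.map f))] at h1
  -- Inserting the merged map into `M.μ` is the same as merging two entries inside a block.
  have h2 : ∑ C ∈ blockings l, mergeBlocks τ (fun C' => opList M.μ (C'.map f)) C =
      ∑ t ∈ splits l, eps τ t.1 • ∑ P ∈ blockings t.1, ∑ R ∈ blockings t.2.2,
        opList M.μ (P.map f ++ merge τ 0 t.2.1 f :: R.map f) := by
    simp only [mergeBlocks]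
    rw [sum_blockings_splits l (fun P Q R => eps τ P.flatten •
      mergeBlockAt τ (fun C' => opList M.μ (C'.map f)) P Q R)]
    refine Finset.sum_congr rfl fun t _ => ?_
    rw [Finset.smul_sum]
    refine Finset.sum_congr rfl fun P hP => ?_
    rw [Finset.smul_sum]
    refine Finset.sum_congr rfl fun R _ => ?_
    rw [(mem_blockings.1 hP).1, ← Finset.smul_sum]
    congr 1
    have hmerge : merge τ 0 t.2.1 (fun b => opList M.μ ((P ++ b :: R).map f)) =
        opList M.μ (P.map f ++ merge τ 0 t.2.1 f :: R.map f) := by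
      rw [← opSlot_apply]
      refine Eq.trans ?_ (merge_map (L := 0) (L' := 0) (opSlot M.μ (P.map f) (R.map f)).toAddMonoidHom
        (by simp) t.2.1 f)
      congr 1
      funext b
      simp [opSlot_apply]
    rw [← hmerge]
    by_cases hb : t.2.1 = []
    · rw [hb, sum_blockings_nil, merge_nil, mergeBlockAt_of_length_ne (by simp)]
    · rw [Finset.sum_eq_single [t.2.1]]
      · rfl
      · intro Q hQ hne
        refine mergeBlockAt_of_length_ne fun hl => hne ?_
        obtain ⟨b, rfl⟩ := List.length_eq_one_iff.1 hl
        simpa using (mem_blockings.1 hQ).1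
      · intro h
        simp [mem_blockings, Ne.symm hb] at h
  have h3 : ∑ C ∈ blockings l, mergeBlocks τ (fun C' => opList M.μ (C'.map f)) C =
      merge τ 0 l (defect M τ f) := by
    rw [← merge_sum_blockings]
    simp only [hD]
    rw [merge_add, merge_merge (by simp), add_zero]
  -- The sum of the two terms is the sum of the `A_∞`-relations over all block decompositions.
  rw [← h3, h2, ← h1, ← Finset.sum_add_distrib]
  refine Finset.sum_congr rfl fun t _ => ?_
  rw [← smul_add, ← Finset.sum_add_distrib, Finset.smul_sum]
  refine Finset.sum_congr rfl fun P hP => ?_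
  rw [← Finset.sum_add_distrib, Finset.smul_sum]
  refine Finset.sum_congr rfl fun R _ => ?_
  rw [(mem_blockings.1 hP).1, ← Finset.smul_sum, ← opSlot_apply, ← opSlot_apply, ← map_add, ← hD,
    map_sum]
  simp only [opSlot_apply]

/-- If the defects vanish up to length `d`, those of length `d + 1` are cocycles: all other terms of
`defect_equation` vanish. -/
theorem d_defect_eq_zero (hf : ∀ b, f b ∈ 𝒱 (rdeg δ b + 1)) {d : ℕ}
    (hd : ∀ l, l.length ≤ d → defect M (sgn (par δ)) f l = 0) {l : List ℕ} (hl : l.length = d + 1) :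
    M.d (defect M (sgn (par δ)) f l) = 0 := by
  have h := defect_equation (M := M) hf l
  rw [Finset.sum_eq_single ([], l, [])] at h
  · rw [merge_congr (ψ := fun _ => 0) (fun l' hl' => hd _ (by omega)), merge_zero, add_zero,
      sum_blockings_nil, sum_blockings_nil, eps_nil, one_smul] at h
    rwa [List.map_nil, List.nil_append, M.opList_singleton] at h
  · rintro ⟨P, Q, R⟩ ht hne
    rw [mem_splits] at ht
    simp only at ht
    have hQ : Q.length ≤ d := by
      by_contra hQ
      have := congrArg List.length ht
      simp only [List.length_append] at this
      have hP : P = [] := List.eq_nil_of_length_eq_zero (by omega)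
      have hR : R = [] := List.eq_nil_of_length_eq_zero (by omega)
      subst hP hR
      simp only [List.nil_append, List.append_nil] at ht
      exact hne (by rw [ht])
    simp only [hd Q hQ]
    refine smul_eq_zero_of_right _ (Finset.sum_eq_zero fun P _ => Finset.sum_eq_zero fun R _ => ?_)
    rw [← opSlot_apply, map_zero]
  · intro h
    simp [mem_splits] at h

/-- If the defects vanish up to length `d`, then `defect_equation` in length `d + 2` says that, up to a
coboundary, those of length `d + 1` satisfy the Hochschild cocycle condition. -/
theorem defect_equation_of_length (hf : ∀ b, f b ∈ 𝒱 (rdeg δ b + 1)) {d : ℕ}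
    (hd : ∀ l, l.length ≤ d → defect M (sgn (par δ)) f l = 0) (x : ℕ) (l : List ℕ) (y : ℕ)
    (hl : l.length = d) :
    M.d (defect M (sgn (par δ)) f (x :: (l ++ [y]))) +
      eps (sgn (par δ)) [x] •
        opList M.μ [f [x], defect M (sgn (par δ)) f (l ++ [y])] +
      opList M.μ [defect M (sgn (par δ)) f (x :: l), f [y]] +
      merge (sgn (par δ)) 0 (x :: (l ++ [y])) (defect M (sgn (par δ)) f) = 0 := by
  have h := defect_equation (M := M) hf (x :: (l ++ [y]))
  rw [← Finset.sum_subset (s₁ := {([], x :: (l ++ [y]), []), ([x], l ++ [y], []),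
    ([], x :: l, [y])})] at h
  · rw [Finset.sum_insert (by simp), Finset.sum_insert (by simp), Finset.sum_singleton] at h
    simp only [sum_blockings_nil, sum_blockings_singleton, eps_nil, one_smul] at h
    rw [← h, ← M.opList_singleton]
    simp [add_assoc]
  · intro t ht
    simp only [Finset.mem_insert, Finset.mem_singleton] at ht
    rcases ht with rfl | rfl | rfl <;> simp [mem_splits]
  · rintro ⟨P, Q, R⟩ ht hne
    rw [mem_splits] at ht
    simp only at ht
    have hQ : Q.length ≤ d := by
      by_contra hQ
      apply hne
      have hlen := congrArg List.length ht
      simp only [List.length_append, List.length_cons, List.length_nil] at hlen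
      rcases P with _ | ⟨p, P⟩
      · rcases R.eq_nil_or_concat with rfl | ⟨R, r, rfl⟩
        · simp only [List.nil_append, List.append_nil] at ht
          simp [ht]
        · have hR : R = [] := List.eq_nil_of_length_eq_zero (by simp at hlen; omega)
          subst hR
          have ht' : Q ++ [r] = (x :: l) ++ [y] := by simpa using ht
          have := List.append_inj' ht' rfl
          simp only [List.cons.injEq, and_true] at this
          simp [this.1, this.2]
      · have hP : P = [] := List.eq_nil_of_length_eq_zero (by simp at hlen; omega)
        have hR : R = [] := List.eq_nil_of_length_eq_zero (by simp at hlen; omega)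
        subst hP hR
        simp only [List.cons_append, List.nil_append, List.append_nil, List.cons.injEq] at ht
        simp [ht.1, ht.2]
    simp only [hd Q hQ]
    refine smul_eq_zero_of_right _ (Finset.sum_eq_zero fun P _ => Finset.sum_eq_zero fun R _ => ?_)
    rw [← opSlot_apply, map_zero]

/-! ### Dependence of the defect on the maps -/

variable {τ : ℤ} {f' : List ℕ → V}

theorem length_le_of_mem_blockings {l b : List ℕ} {C : List (List ℕ)} (hC : C ∈ blockings l)
    (hb : b ∈ C) : b.length ≤ l.length := by
  rw [← (mem_blockings.1 hC).1]
  exact (List.sublist_flatten_of_mem hb).length_le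

theorem eq_nil_of_length_flatten {C : List (List ℕ)} (hC : [] ∉ C) (h : C.flatten.length = 0) :
    C = [] := by
  rcases C with _ | ⟨_ | ⟨x, b⟩, C⟩
  · rfl
  · simp at hC
  · simp at h

theorem eq_singleton_of_length_flatten {C : List (List ℕ)} (hC : [] ∉ C)
    (h : C.flatten.length = 1) : C = [C.flatten] := by
  rcases C with _ | ⟨_ | ⟨x, b⟩, C⟩
  · simp at h
  · simp at hC
  · simp only [List.flatten_cons, List.length_append, List.length_cons] at h
    have hb : b = [] := List.eq_nil_of_length_eq_zero (by omega)
    have hC' : C = [] := eq_nil_of_length_flatten (fun h => hC (by simp [h])) (by omega)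
    simp [hb, hC']

/-- A block decomposition of `l` with a block of the length of `l` is trivial. -/
theorem eq_singleton_of_mem_blockings {l b : List ℕ} {C : List (List ℕ)} (hC : C ∈ blockings l)
    (hb : b ∈ C) (h : l.length ≤ b.length) : C = [l] := by
  obtain ⟨rfl, hn⟩ := mem_blockings.1 hC
  obtain ⟨P, R, rfl⟩ := List.append_of_mem hb
  simp only [List.flatten_append, List.flatten_cons, List.length_append] at h
  have hP : P = [] := eq_nil_of_length_flatten (fun h => hn (by simp [h])) (by omega)
  have hR : R = [] := eq_nil_of_length_flatten (fun h => hn (by simp [h])) (by omega)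
  simp [hP, hR]

/-- The block decompositions of a list that have a block containing all entries but at most one. -/
theorem mem_of_mem_blockings {x y : ℕ} {l b : List ℕ} {C : List (List ℕ)}
    (hC : C ∈ blockings (x :: (l ++ [y]))) (hb : b ∈ C) (h : l.length + 1 ≤ b.length) :
    C ∈ ({[x :: (l ++ [y])], [[x], l ++ [y]], [x :: l, [y]]} : Finset (List (List ℕ))) := by
  obtain ⟨hC', hn⟩ := mem_blockings.1 hC
  simp only [Finset.mem_insert, Finset.mem_singleton]
  by_cases hb' : l.length + 2 ≤ b.length
  · exact Or.inl (eq_singleton_of_mem_blockings hC hb (by simpa [Nat.succ_le_iff] using hb'))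
  obtain ⟨P, R, rfl⟩ := List.append_of_mem hb
  have hlen := congrArg List.length hC'
  simp only [List.flatten_append, List.flatten_cons, List.length_append, List.length_cons,
    List.length_nil] at hlen
  have hnP : [] ∉ P := fun h => hn (by simp [h])
  have hnR : [] ∉ R := fun h => hn (by simp [h])
  right
  rcases Nat.eq_zero_or_pos P.flatten.length with hP | hP
  · right
    have hP' := eq_nil_of_length_flatten hnP hP
    subst hP'
    have hR : R.flatten.length = 1 := by omega
    rw [eq_singleton_of_length_flatten hnR hR]
    simp only [List.nil_append, List.flatten_cons] at hC' ⊢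
    have hC'' : b ++ R.flatten = (x :: l) ++ [y] := by simpa using hC'
    obtain ⟨rfl, h'⟩ := List.append_inj' hC'' (by simpa using hR)
    rw [h']
  · left
    have hR := eq_nil_of_length_flatten hnR (by omega)
    subst hR
    have hP : P.flatten.length = 1 := by omega
    rw [eq_singleton_of_length_flatten hnP hP]
    have hC'' : P.flatten ++ b = [x] ++ (l ++ [y]) := by simpa using hC'
    obtain ⟨h', rfl⟩ := List.append_inj hC'' (by simpa using hP)
    rw [h']
    rfl

theorem opList_map_congr {C : List (List ℕ)} (h : ∀ b ∈ C, f' b = f b) :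
    opList M.μ (C.map f') = opList M.μ (C.map f) := by
  rw [List.map_congr_left h]

theorem defect_congr {l : List ℕ} (h : ∀ b, b.length ≤ l.length → f' b = f b) :
    defect M τ f' l = defect M τ f l := by
  rw [defect, defect, merge_congr (fun l' hl' => h l' (by omega))]
  congr 1
  exact Finset.sum_congr rfl fun C hC =>
    opList_map_congr fun b hb => h b (length_le_of_mem_blockings hC hb)

/-- A change of the map on lists of the length of `l` changes the defect by a coboundary. -/
theorem defect_of_eq_of_length_lt {l : List ℕ} (hl : l ≠ [])
    (h : ∀ b, b.length < l.length → f' b = f b) :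
    defect M τ f' l = defect M τ f l + M.d (f' l - f l) := by
  rw [defect, defect, merge_congr (fun l' hl' => h l' (by omega)), sub_add_eq_add_sub]
  congr 1
  rw [← sub_eq_iff_eq_add', ← Finset.sum_sub_distrib, Finset.sum_eq_single [l]]
  · simp [M.opList_singleton]
  · intro C hC hne
    rw [sub_eq_zero]
    refine opList_map_congr fun b hb => h b ?_
    by_contra hlt
    exact hne (eq_singleton_of_mem_blockings hC hb (by omega))
  · intro h
    simp [mem_blockings, Ne.symm hl] at h

/-- A change `f' - f` of the map on lists one entry shorter than a given one changes the defect by the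
Hochschild coboundary of `f' - f`. -/
theorem defect_of_eq_of_length_ne {x y : ℕ} {l : List ℕ} (hl : l ≠ [])
    (h : ∀ b, b.length ≠ l.length + 1 → f' b = f b) :
    defect M τ f' (x :: (l ++ [y])) = defect M τ f (x :: (l ++ [y])) +
      (opList M.μ [f [x], f' (l ++ [y]) - f (l ++ [y])] +
        opList M.μ [f' (x :: l) - f (x :: l), f [y]] -
        merge τ 0 (x :: (l ++ [y])) (fun b => f' b - f b)) := by
  have hl' : l.length ≠ 0 := fun h => hl (List.eq_nil_of_length_eq_zero h)
  have key : ∑ C ∈ blockings (x :: (l ++ [y])), (opList M.μ (C.map f') - opList M.μ (C.map f)) =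
      opList M.μ [f [x], f' (l ++ [y]) - f (l ++ [y])] +
        opList M.μ [f' (x :: l) - f (x :: l), f [y]] := by
    have hne : [[x], l ++ [y]] ≠ [x :: l, [y]] := by simp [Ne.symm hl]
    rw [← Finset.sum_subset (s₁ := {[x :: (l ++ [y])], [[x], l ++ [y]], [x :: l, [y]]})]
    · rw [Finset.sum_insert (by simp), Finset.sum_insert (by simpa using hne),
        Finset.sum_singleton]
      simp only [List.map_cons, List.map_nil]
      rw [h (x :: (l ++ [y])) (by simp), h [x] (by simpa using hl),
        h [y] (by simpa using hl), sub_self, zero_add]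
      have h1 := opSlot_apply (F := M.μ) [f [x]] []
      have h2 := opSlot_apply (F := M.μ) [] [f [y]]
      simp only [List.cons_append, List.nil_append] at h1 h2
      rw [← h1, ← h1, ← h1, ← h2, ← h2, ← h2, map_sub, map_sub]
    · intro C hC
      simp only [Finset.mem_insert, Finset.mem_singleton] at hC
      rcases hC with rfl | rfl | rfl <;> simp [mem_blockings]
    · intro C hC hC'
      rw [sub_eq_zero]
      refine opList_map_congr fun b hb => h b fun hlen => hC' ?_
      exact mem_of_mem_blockings hC hb hlen.ge
  rw [← key, merge_sub, Finset.sum_sub_distrib, defect, defect]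
  abel

end Defect

/-! ### Obstruction theory -/

section Obstruction

open Polynomial AInfAlgebra.CohomologyIso

variable {K : Type*} {G : Type*} {V : Type*} [Field K] [CommRing G] [DecidableEq G]
  [AddCommGroup V] [Module K V] {par : G →+* ZMod 2}
  {𝒱 : G → Submodule K V} [DirectSum.Decomposition 𝒱] {M : AInfAlgebra par 𝒱} {δ : G}

/-- The family `f` is a family of maps on monomials of the right degrees, which induces `e` on
cohomology and satisfies the equations of an `A_∞`-homomorphism for at most `d` inputs. -/
structure IsPartialHom (e : M.CohomologyIso (polynomialGrading K δ)) (d : ℕ) (f : List ℕ → V) :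
    Prop where
  mem : ∀ l, f l ∈ 𝒱 (rdeg δ l + 1)
  nil : f [] = 0
  represents : ∀ k, e.Represents (f [k]) (X ^ k)
  defect_eq_zero : ∀ l, l.length ≤ d → defect M (sgn (par δ)) f l = 0

variable {e : M.CohomologyIso (polynomialGrading K δ)}

theorem sgn_sgn_smul {N : Type*} [AddCommGroup N] (z : ZMod 2) (v : N) : sgn z • sgn z • v = v := by
  rw [smul_smul, sgn_mul_self, one_smul]

/-- If the defects of `f` vanish up to length `d - 1` and represent zero in length `d`, then changing
`f` on lists of length `d` kills them. -/
theorem exists_isPartialHom_of_represents_zero {d : ℕ} (hd : 2 ≤ d) {f : List ℕ → V}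
    (hf : IsPartialHom e (d - 1) f)
    (h0 : ∀ l, l.length = d → e.Represents (defect M (sgn (par δ)) f l) 0) :
    ∃ f', IsPartialHom e d f' ∧ ∀ l, l.length < d → f' l = f l := by
  have hz : ∀ l, ∃ z ∈ 𝒱 (rdeg δ l + 1), l.length = d → M.d z = defect M (sgn (par δ)) f l := by
    intro l
    by_cases hl : l.length = d
    · obtain ⟨z, hz, hdz⟩ := (h0 l hl).exists_primitive (g := rdeg δ l + 1) (by
        rw [add_assoc, one_add_one_eq_two]
        exact defect_mem hf.mem l)
      exact ⟨z, hz, fun _ => hdz⟩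
    · exact ⟨0, zero_mem _, fun h => absurd h hl⟩
  choose z hz hdz using hz
  have hlt : ∀ l, l.length < d → (if l.length = d then f l - z l else f l) = f l :=
    fun l hl => if_neg (by omega)
  refine ⟨fun l => if l.length = d then f l - z l else f l, ⟨?_, ?_, ?_, ?_⟩, hlt⟩
  · intro l
    split_ifs
    · exact sub_mem (hf.mem l) (hz l)
    · exact hf.mem l
  · rw [hlt [] (by simp; omega), hf.nil]
  · intro k
    rw [hlt [k] (by simp; omega)]
    exact hf.represents k
  · intro l hl
    rcases hl.lt_or_eq with hl | hl
    · rw [defect_congr (f := f) fun b hb => hlt b (by omega)]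
      exact hf.defect_eq_zero l (by omega)
    · rw [defect_of_eq_of_length_lt (f := f) (by rintro rfl; simp at hl; omega)
        fun b hb => hlt b (by omega), if_pos hl, sub_sub_cancel_left, map_neg, hdz l hl,
        add_neg_cancel]

/-- A family that satisfies the equations for at most two inputs. -/
theorem exists_isPartialHom_two (e : M.CohomologyIso (polynomialGrading K δ)) :
    ∃ f, IsPartialHom e 2 f := by
  have h : ∀ k : ℕ, ∃ z ∈ 𝒱 (k * δ), e.Represents z (X ^ k) := fun k =>
    exists_represents_of_mem (Submodule.subset_span ⟨k, rfl, rfl⟩)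
  choose z hz hrep using h
  let f : List ℕ → V := fun l => match l with
    | [x] => z x
    | _ => 0
  have hf : IsPartialHom e 1 f := by
    refine ⟨?_, rfl, hrep, ?_⟩
    · intro l
      match l with
      | [] => exact zero_mem _
      | [x] =>
        convert hz x using 2
        simp [rdeg_cons, rdeg_nil]
      | _ :: _ :: _ => exact zero_mem _
    · intro l hl
      match l with
      | [] =>
        rw [defect, sum_blockings_nil, merge_nil, sub_zero]
        exact M.opList_nil
      | [x] =>
        rw [defect, sum_blockings_singleton, merge_singleton]
        simpa [M.opList_singleton] using (hrep x).d_eq_zero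
      | _ :: _ :: _ => simp at hl
  obtain ⟨f', hf', -⟩ := exists_isPartialHom_of_represents_zero le_rfl hf (fun l hl => by
    obtain ⟨x, y, rfl⟩ := List.length_eq_two.1 hl
    rw [defect, sum_blockings_cons_cons, sum_blockings_singleton, sum_blockings_singleton,
      merge_cons_cons, merge_singleton]
    -- In length two the obstruction vanishes because `e` is multiplicative.
    have h1 := (hrep x).opList_pair (hrep y) (hz x)
    have h2 := (hrep (x + y)).zsmul (sgn (par δ) ^ x)
    have h3 := (h1.add (represents_d (M := M) 0)).sub h2
    rw [sgn_par_natCast_mul, ← pow_add, add_comm y x, add_zero, sub_self] at h3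
    convert h3 using 1
    simp [consHead, f, M.opList_singleton])
  exact ⟨f', hf'⟩

/-- The obstruction to extending a family from `d` to `d + 1` inputs is a Hochschild cocycle, so that it
vanishes after a change of the family on lists of length `d`. -/
theorem exists_isPartialHom_succ {d : ℕ} (hd : 2 ≤ d) {f : List ℕ → V} (hf : IsPartialHom e d f) :
    ∃ f', IsPartialHom e (d + 1) f' ∧ ∀ l, l.length < d → f' l = f l := by
  set τ := sgn (par δ) with hτ
  have hp : ∀ l, ∃ p ∈ polynomialGrading K δ (rdeg δ l + 2),
      (l.length = d + 1 → e.Represents (defect M τ f l) p) ∧ (l.length ≠ d + 1 → p = 0) := by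
    intro l
    by_cases hl : l.length = d + 1
    · obtain ⟨p, hp, hrep⟩ := exists_of_cocycle_mem (e := e) (defect_mem hf.mem l)
        (d_defect_eq_zero hf.mem hf.defect_eq_zero hl)
      exact ⟨p, hp, fun _ => hrep, fun h => absurd hl h⟩
    · exact ⟨0, zero_mem _, fun h => absurd h hl, fun _ => rfl⟩
  choose φ hφ hrep hzero using hp
  have hpar2 : par 2 = 0 := by rw [map_ofNat]; rfl
  have hcocycle : ∀ x y z l, CocycleAt τ φ x (y :: z :: l) := by
    intro x y z l
    by_cases hl : l.length + 2 = d + 1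
    · obtain ⟨l', w, hl'⟩ : ∃ l' w, y :: z :: l = l' ++ [w] :=
        ⟨_, _, (List.dropLast_append_getLast (by simp)).symm⟩
      have hlen := congrArg List.length hl'
      simp only [List.length_append, List.length_cons, List.length_nil] at hlen
      rw [hl']
      -- The classes of the terms of the equation give the cocycle condition.
      have h := defect_equation_of_length hf.mem hf.defect_eq_zero x l' w (by omega)
      have h1 := represents_d (e := e) (defect M τ f (x :: (l' ++ [w])))
      have h2 := ((hf.represents x).opList_pair (hrep (l' ++ [w]) (by simp; omega))
        (hf.mem [x])).zsmul (eps τ [x])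
      have h3 := (hrep (x :: l') (by simp; omega)).opList_pair (hf.represents w)
        (defect_mem hf.mem (x :: l'))
      have h4 := represents_merge (e := e) (τ := τ) (l := x :: (l' ++ [w])) (D := defect M τ f)
        (φ := φ) (fun l'' h'' => hrep l'' (by simp at h''; omega))
      have h5 := ((h1.add h2).add h3).add h4
      rw [h] at h5
      have h6 := h5.unique represents_zero
      rw [map_add, map_add, hpar2, map_one, add_zero, sgn_add, sgn_par_rdeg, sgn_par_rdeg, sgn_one,
        mul_neg_one, ← hτ, neg_smul, smul_neg, ← sgn_par_rdeg, sgn_sgn_smul, hτ] at h6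
      have h7 := merge_append_singleton (τ := τ) (L := mulPow K) (x :: l') w φ
      rw [List.cons_append] at h7
      rw [CocycleAt, h7, mulPow_apply, ← sub_eq_zero, mul_comm, ← neg_eq_zero, ← h6]
      abel
    · rw [CocycleAt, hzero _ (by simpa using hl), mul_zero,
        merge_congr (ψ := fun _ => 0) (fun l' hl' => hzero _ (by simp at hl'; omega)), merge_zero]
  -- Subtracting representatives of a primitive of `φ` makes the defects of length `d + 1` exact.
  set ψ := primitive τ φ with hψ
  have hz : ∀ l, ∃ z ∈ 𝒱 (rdeg δ l + 1), e.Represents z (ψ l) := fun l =>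
    exists_represents_of_mem (primitive_mem hφ l)
  choose z hz hzrep using hz
  let f₁ : List ℕ → V := fun l => if l.length = d then f l - z l else f l
  have hne : ∀ l, l.length ≠ d → f₁ l = f l := fun l hl => if_neg hl
  have heq : ∀ l, l.length = d → f₁ l - f l = (-1 : ℤ) • z l := fun l hl => by
    simp only [f₁, if_pos hl, sub_sub_cancel_left, neg_smul, one_smul]
  have hf₁ : IsPartialHom e d f₁ := by
    refine ⟨?_, ?_, ?_, ?_⟩
    · intro l
      by_cases hl : l.length = d
      · simp only [f₁, if_pos hl]
        exact sub_mem (hf.mem l) (hz l)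
      · rw [hne l hl]
        exact hf.mem l
    · rw [hne [] (by simp; omega), hf.nil]
    · intro k
      rw [hne [k] (by simp; omega)]
      exact hf.represents k
    · intro l hl
      rcases hl.lt_or_eq with hl' | hl'
      · rw [defect_congr (f := f) fun b hb => hne b (by omega)]
        exact hf.defect_eq_zero l hl
      · rw [defect_of_eq_of_length_lt (f := f) (by rintro rfl; simp at hl'; omega)
          fun b hb => hne b (by omega), hf.defect_eq_zero l hl, heq l hl', map_zsmul,
          (hzrep l).d_eq_zero, smul_zero, add_zero]
  obtain ⟨f', hf', h⟩ := exists_isPartialHom_of_represents_zero (d := d + 1) (by omega) hf₁ (by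
    intro l hl
    obtain ⟨x, y, t, rfl⟩ : ∃ x y t, l = x :: y :: t := by
      match l, hl with
      | [], hl => simp at hl
      | [x], hl => simp at hl; omega
      | x :: y :: t, _ => exact ⟨x, y, t, rfl⟩
    have hφψ := coboundary_primitive (sgn_mul_self _) φ hcocycle x y t
    have hrepφ := hrep _ hl
    obtain ⟨l', w, hl'⟩ : ∃ l' w, y :: t = l' ++ [w] :=
      ⟨_, _, (List.dropLast_append_getLast (by simp)).symm⟩
    rw [coboundary] at hφψ
    rw [hl'] at hφψ hl hrepφ ⊢
    have hlen : l'.length + 1 = d := by simp at hl; omega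
    rw [defect_of_eq_of_length_ne (f := f) (by rintro rfl; simp at hlen; omega)
      (fun b hb => hne b (by omega)), heq _ (by simpa using hlen), heq _ (by simpa using hlen)]
    have h1 := (hf.represents x).opList_pair ((hzrep (l' ++ [w])).zsmul (-1)) (hf.mem [x])
    have h2 := ((hzrep (x :: l')).zsmul (-1)).opList_pair (hf.represents w)
      (zsmul_mem (hz (x :: l')) (-1))
    have h3 := represents_merge (e := e) (τ := τ) (l := x :: (l' ++ [w]))
        (D := fun b => f₁ b - f b) (φ := fun b => (-1 : ℤ) • ψ b)
        (fun l'' h'' => by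
          rw [heq l'' (by simp at h''; omega)]
          exact (hzrep l'').zsmul _)
    have h4 := hrepφ.add ((h1.add h2).sub h3)
    convert h4 using 1
    have h5 : merge τ 0 (x :: (l' ++ [w])) (fun b => (-1 : ℤ) • ψ b) =
        (-1 : ℤ) • merge τ 0 (x :: (l' ++ [w])) ψ :=
      merge_map (L := 0) (L' := 0) (zsmulAddGroupHom (-1)) (by simp) _ ψ
    have h7 := merge_append_singleton (τ := τ) (L := mulPow K) (x :: l') w ψ
    rw [List.cons_append] at h7
    rw [hφψ, ← hψ, h5, h7, mulPow_apply, map_add, map_add, map_one, sgn_add, sgn_add, sgn_par_rdeg,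
      sgn_par_rdeg, sgn_one, ← hτ, eps_cons x [], eps_nil]
    simp only [neg_smul, one_smul, mul_neg, mul_one, smul_neg, neg_mul, neg_neg,
      mul_comm (X ^ x) (ψ _)]
    abel)
  exact ⟨f', hf', fun l hl => (h l (by omega)).trans (hne l (by omega))⟩

/-- A family that satisfies all the equations of an `A_∞`-homomorphism. -/
theorem exists_isPartialHom_forall (e : M.CohomologyIso (polynomialGrading K δ)) :
    ∃ f, ∀ d, IsPartialHom e d f := by
  obtain ⟨f₀, hf₀⟩ := exists_isPartialHom_two e
  choose! next hnext hlt using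
    fun (d : ℕ) (f : List ℕ → V) (h : 2 ≤ d ∧ IsPartialHom e d f) =>
      exists_isPartialHom_succ h.1 h.2
  -- The value on a list is eventually constant along the recursion.
  let s : ℕ → List ℕ → V := fun n => Nat.rec f₀ (fun n f => next (n + 2) f) n
  have hs : ∀ n, IsPartialHom e (n + 2) (s n) := by
    intro n
    induction n with
    | zero => exact hf₀
    | succ n ih => exact hnext (n + 2) (s n) ⟨by omega, ih⟩
  have hstab : ∀ l n, l.length ≤ n → s n l = s l.length l := by
    intro l n hn
    induction n, hn using Nat.le_induction with
    | base => rfl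
    | succ n hn ih => exact (hlt (n + 2) (s n) ⟨by omega, hs n⟩ l (by omega)).trans ih
  refine ⟨fun l => s l.length l, fun d => ⟨fun l => (hs _).mem l, (hs 0).nil,
    fun k => (hs [k].length).represents k, fun l _ => ?_⟩⟩
  rw [defect_congr (f := s l.length) fun b hb => (hstab b _ hb).symm]
  exact (hs _).defect_eq_zero l (by omega)

end Obstruction

/-! ### Multilinear extension from monomials -/

section Extension

open Polynomial

/-- A property that is linear in each of the variables `a i`, `i ∈ s`, holds on products of spans if it
holds on products of spanning sets. -/
theorem span_induction_update {K A ι : Type*} [Semiring K] [AddCommMonoid A] [Module K A]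
    [DecidableEq ι] (S : ι → Set A) (p : (ι → A) → Prop) (s : Finset ι)
    (hp : ∀ a, ∀ i ∈ s, ∃ P : Submodule K A, ∀ x, x ∈ P ↔ p (Function.update a i x))
    (h : ∀ a, (∀ i ∈ s, a i ∈ S i) → p a) (a : ι → A)
    (ha : ∀ i ∈ s, a i ∈ Submodule.span K (S i)) : p a := by
  induction s using Finset.induction_on generalizing p a with
  | empty => exact h a (by simp)
  | insert i s hi ih =>
    have key := ih (fun b => p (Function.update b i (a i))) (fun b j hj => ?_) (fun b hb => ?_) a
      (fun j hj => ha j (Finset.mem_insert_of_mem hj))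
    · simpa using key
    · have hji : j ≠ i := fun h => hi (h ▸ hj)
      obtain ⟨P, hP⟩ := hp (Function.update b i (a i)) j (Finset.mem_insert_of_mem hj)
      exact ⟨P, fun x => by rw [hP, Function.update_comm hji]⟩
    · obtain ⟨P, hP⟩ := hp b i (Finset.mem_insert_self i s)
      rw [← hP]
      refine Submodule.span_le.2 (fun x hx => ?_) (ha i (Finset.mem_insert_self i s))
      refine (hP x).2 (h _ fun j hj => ?_)
      by_cases hji : j = i
      · subst hji
        rwa [Function.update_self]
      · rw [Function.update_of_ne hji]
        exact hb j (Finset.mem_of_mem_insert_of_ne hj hji)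

variable {K : Type*} [Field K] {V : Type*} [AddCommGroup V] [Module K V]

/-- A property of `d` polynomials that is linear in each of them holds for homogeneous polynomials if it
holds for monomials. -/
theorem polynomialGrading_induction {G : Type*} [CommRing G] {δ : G} {d : ℕ} {p : (ℕ → K[X]) → Prop} (g : ℕ → G)
    (hp : ∀ a, ∀ i < d, ∃ P : Submodule K K[X], ∀ x, x ∈ P ↔ p (Function.update a i x))
    (h : ∀ (l : List ℕ) (a : ℕ → K[X]), l.length = d → (∀ i (h : i < l.length), g i = l[i] * δ) →
      (∀ i (h : i < l.length), a i = X ^ l[i]) → p a)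
    (a : ℕ → K[X]) (ha : ∀ i < d, a i ∈ polynomialGrading K δ (g i)) : p a := by
  refine span_induction_update (K := K) (fun i => {p | ∃ k : ℕ, (k : G) * δ = g i ∧ p = X ^ k}) p
    (Finset.range d) (fun a i hi => hp a i (Finset.mem_range.1 hi)) (fun a ha => ?_) a
    (fun i hi => ha i (Finset.mem_range.1 hi))
  choose k hk hak using fun i : Fin d => ha i (Finset.mem_range.2 i.2)
  refine h (List.ofFn k) a (by simp) (fun i hi => ?_) (fun i hi => ?_)
  · rw [List.getElem_ofFn, hk]
  · rw [List.getElem_ofFn, ← hak]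

open Classical in
/-- The multilinear map on `K[u]` with given values on monomials. -/
noncomputable def extendMonomials (K : Type*) [Field K] {V : Type*} [AddCommGroup V] [Module K V]
    (f : List ℕ → V) (k : ℕ) : MultilinearMap K (fun _ : Fin k => K[X]) V :=
  (DFinsupp.lsum ℕ fun _ : Fin k → ℕ => (LinearMap.id : V →ₗ[K] V)).compMultilinearMap
    ((MultilinearMap.dfinsuppFamily fun s : Fin k → ℕ =>
      MultilinearMap.mkPiRing K (Fin k) (f (List.ofFn s))).compLinearMap fun _ =>
        (finsuppLequivDFinsupp K).toLinearMap ∘ₗ (basisMonomials K).repr.toLinearMap)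

theorem extendMonomials_apply (f : List ℕ → V) {k : ℕ} (s : Fin k → ℕ) :
    extendMonomials K f k (fun i => X ^ s i) = f (List.ofFn s) := by
  classical
  have h : ∀ n : ℕ, (finsuppLequivDFinsupp K) ((basisMonomials K).repr (X ^ n : K[X])) =
      DFinsupp.single (β := fun _ : ℕ => K) n (1 : K) := by
    intro n
    have hn := (basisMonomials K).repr_self n
    rw [coe_basisMonomials] at hn
    rw [X_pow_eq_monomial, hn]
    exact Finsupp.toDFinsupp_single n 1
  simp only [extendMonomials, LinearMap.compMultilinearMap_apply,
    MultilinearMap.compLinearMap_apply, LinearMap.comp_apply, LinearEquiv.coe_coe, h]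
  rw [MultilinearMap.dfinsuppFamily_single]
  simp

theorem opList_extendMonomials (f : List ℕ → V) (l : List ℕ) :
    opList (extendMonomials K f) (l.map fun n => (X ^ n : K[X])) = f l := by
  rw [← opList_eq (k := l.length) (a := fun i => X ^ l.get i) (by simp) (fun i => by simp),
    extendMonomials_apply, List.ofFn_get]

end Extension

/-! ### Linearity of the terms of the equations of an `A_∞`-homomorphism -/

section Linearity

variable {K : Type*} {V : Type*} {W : Type*} {U : Type*} [Field K] [AddCommGroup V] [Module K V]
  [AddCommGroup W] [Module K W] [AddCommGroup U] [Module K U]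

/-- The map `Φ` is linear in the `i`-th variable. -/
def LinearAt (K : Type*) {V W : Type*} [Field K] [AddCommGroup V] [Module K V]
    [AddCommGroup W] [Module K W] (Φ : (ℕ → V) → W) (i : ℕ) : Prop :=
  ∀ a, ∃ L : V →ₗ[K] W, ∀ x, L x = Φ (Function.update a i x)

theorem LinearAt.sum {ι : Type*} {Φ : ι → (ℕ → V) → W} {i : ℕ} {s : Finset ι}
    (h : ∀ j ∈ s, LinearAt K (Φ j) i) : LinearAt K (fun a => ∑ j ∈ s, Φ j a) i := by
  intro a
  have h' : ∀ j, ∃ L : V →ₗ[K] W, j ∈ s → ∀ x, L x = Φ j (Function.update a i x) := by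
    intro j
    by_cases hj : j ∈ s
    · obtain ⟨L, hL⟩ := h j hj a
      exact ⟨L, fun _ => hL⟩
    · exact ⟨0, fun h => absurd h hj⟩
  choose L hL using h'
  refine ⟨∑ j ∈ s, L j, fun x => ?_⟩
  rw [LinearMap.sum_apply]
  exact Finset.sum_congr rfl fun j hj => hL j hj x

/-- A composite of multilinear maps is linear in a variable that enters exactly one of the inner maps,
if it enters that map linearly. -/
theorem linearAt_comp {k : ℕ} (f : MultilinearMap K (fun _ : Fin k => W) U)
    {Φ : Fin k → (ℕ → V) → W} {i : ℕ} (j : Fin k) (hj : LinearAt K (Φ j) i)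
    (hne : ∀ j', j' ≠ j → ∀ a x, Φ j' (Function.update a i x) = Φ j' a) :
    LinearAt K (fun a => f (fun j' => Φ j' a)) i := by
  intro a
  obtain ⟨L, hL⟩ := hj a
  refine ⟨f.toLinearMap (fun j' => Φ j' a) j ∘ₗ L, fun x => ?_⟩
  rw [LinearMap.comp_apply, MultilinearMap.toLinearMap_apply, hL]
  congr 1
  funext j'
  by_cases h : j' = j
  · subst h
    rw [Function.update_self]
  · rw [Function.update_of_ne h, hne j' h]

theorem linearAt_apply (i : ℕ) : LinearAt K (fun a : ℕ → V => a i) i :=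
  fun _ => ⟨LinearMap.id, fun x => by simp⟩

theorem linearAt_composition {d : ℕ} (c : Composition d)
    (f : MultilinearMap K (fun _ : Fin c.length => W) U)
    (F : ∀ k : ℕ, MultilinearMap K (fun _ : Fin k => V) W) {i : ℕ} (hi : i < d) :
    LinearAt K (fun a => f fun j => F (c.blocksFun j) fun j' => a (c.embedding j j' : ℕ)) i := by
  have hemb := c.embedding_comp_inv ⟨i, hi⟩
  refine linearAt_comp f (Φ := fun j a => F (c.blocksFun j) fun j' => a (c.embedding j j' : ℕ))
    (c.index ⟨i, hi⟩) ?_ ?_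
  · refine linearAt_comp (F _) (Φ := fun j' a => a (c.embedding (c.index ⟨i, hi⟩) j' : ℕ))
      (c.invEmbedding ⟨i, hi⟩) ?_ ?_
    · rw [hemb]
      exact linearAt_apply i
    · intro j' hj' a x
      refine Function.update_of_ne (fun h => hj' ?_) _ _
      exact (c.embedding (c.index ⟨i, hi⟩)).injective (by rw [hemb]; exact Fin.ext h)
  · intro j hj a x
    congr 1
    funext j'
    refine Function.update_of_ne (fun h => hj ?_) _ _
    rw [← c.index_embedding j j', show c.embedding j j' = ⟨i, hi⟩ from Fin.ext h]

theorem linearAt_insertionTerm {G : Type*} [CommRing G] (par : G →+* ZMod 2)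
    (μ : ∀ k : ℕ, MultilinearMap K (fun _ : Fin k => V) V)
    (F : ∀ k : ℕ, MultilinearMap K (fun _ : Fin k => V) W) (g : ℕ → G) {n m p i : ℕ}
    (hi : i < n + m + p) : LinearAt K (fun a => insertionTerm par μ F g a n m p) i := by
  suffices h : LinearAt K (fun a => F (n + 1 + p)
      (fun j => replaceAt a n m (μ m (fun j' => a (n + j'))) j)) i by
    intro a
    obtain ⟨L, hL⟩ := h a
    exact ⟨sgn (maltese par g n) • L, fun x => by rw [LinearMap.smul_apply, hL]; rfl⟩
  -- The slot of the outer operation that the `i`-th variable enters.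
  obtain ⟨j, hj⟩ : ∃ j : Fin (n + 1 + p),
      (j : ℕ) = if i < n then i else if i < n + m then n else i + 1 - m :=
    ⟨⟨if i < n then i else if i < n + m then n else i + 1 - m, by split_ifs <;> omega⟩, rfl⟩
  refine linearAt_comp (F _)
    (Φ := fun j a => replaceAt a n m (μ m (fun j' => a (n + j'))) j) j ?_ ?_
  · by_cases h : n ≤ i ∧ i < n + m
    · have hjn : (j : ℕ) = n := by rw [hj]; split_ifs <;> omega
      have hm := linearAt_comp (μ m) (Φ := fun (j' : Fin m) (a : ℕ → V) => a (n + j')) (i := i)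
        ⟨i - n, by omega⟩
        (by
          simp only [Nat.add_sub_cancel' h.1]
          exact linearAt_apply (K := K) i)
        (fun j' hj' a x => Function.update_of_ne (fun h' => hj' (Fin.ext (by simp; omega))) _ _)
      simpa [replaceAt, hjn] using hm
    · convert linearAt_apply (K := K) (V := V) i using 2 with a
      simp only [replaceAt, hj]
      split_ifs <;> first | omega | (congr 1 <;> omega)
  · intro j' hj' a x
    have hj'' : (j' : ℕ) ≠ j := fun h => hj' (Fin.ext h)
    rw [hj] at hj''
    simp only [replaceAt]
    split_ifs at hj'' ⊢ <;> first
      | omega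
      | exact Function.update_of_ne (by omega) _ _
      | (congr 1; funext k; exact Function.update_of_ne (by omega) _ _)

theorem linearAt_insertionSum {G : Type*} [CommRing G] (par : G →+* ZMod 2)
    (μ : ∀ k : ℕ, MultilinearMap K (fun _ : Fin k => V) V)
    (F : ∀ k : ℕ, MultilinearMap K (fun _ : Fin k => V) W) (g : ℕ → G) {d i : ℕ}
    (hi : i < d) : LinearAt K (fun a => insertionSum par μ F g a d) i := by
  refine LinearAt.sum fun t ht => linearAt_insertionTerm par μ F g ?_
  rw [Finset.Nat.mem_antidiagonalTuple, Fin.sum_univ_three] at ht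
  omega

end Linearity

/-! ### The `A_∞`-homomorphism -/

section Hom

open Polynomial

variable {K : Type*} {G : Type*} {V : Type*} [Field K] [CommRing G] [DecidableEq G]
  [AddCommGroup V] [Module K V] {par : G →+* ZMod 2}
  {𝒱 : G → Submodule K V} [DirectSum.Decomposition 𝒱] {M : AInfAlgebra par 𝒱} {δ : G}

/-- The insertion of the product of `K[u]` on monomials is the merging differential. -/
theorem insertionSum_extendMonomials (f : List ℕ → V) (l : List ℕ) {g : ℕ → G} {a : ℕ → K[X]}
    (hg : ∀ i (h : i < l.length), g i = l[i] * δ) (ha : ∀ i (h : i < l.length), a i = X ^ l[i]) :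
    insertionSum par (gradedμ par (polynomialGrading K δ)) (extendMonomials K f) g a l.length =
      merge (sgn (par δ)) 0 l f := by
  rw [insertionSum_eq l (fun n => X ^ n) (fun n => (n : G) * δ) hg ha, ← sum_mergeAt]
  refine Finset.sum_congr rfl fun t _ => ?_
  rw [← sgn_par_rdeg, rdeg]
  congr 1
  by_cases hQ : t.2.1.length = 2
  · obtain ⟨x, y, hxy⟩ := List.length_eq_two.1 hQ
    have hmul : opList (gradedμ par (polynomialGrading K δ)) [X ^ x, X ^ y] =
        sgn (par δ) ^ x • X ^ (x + y) := by
      change X ^ y * signMap par (polynomialGrading K δ) (X ^ x) = _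
      have hx : X ^ x ∈ polynomialGrading K δ (x * δ) := Submodule.subset_span ⟨x, rfl, rfl⟩
      rw [signMap_of_mem hx, sgn_par_natCast_mul,
        mul_smul_comm, ← pow_add, add_comm]
    rw [hxy, List.map_cons, List.map_cons, List.map_nil, hmul, ← opSlot_apply, map_zsmul,
      opSlot_apply, mergeAt, ← opList_extendMonomials (K := K) f]
    simp
  · have h0 : opList (gradedμ par (polynomialGrading K δ)) (t.2.1.map fun n => X ^ n) = 0 := by
      rw [opList, gradedμ_of_ne _ _ (by simpa using hQ)]
      rfl
    rw [h0, mergeAt_of_length_ne hQ, ← opSlot_apply, map_zero]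

/-- The sum over compositions, on monomials, in terms of block decompositions. -/
theorem sum_composition_extendMonomials (f : List ℕ → V) (l : List ℕ) {a : ℕ → K[X]}
    (ha : ∀ i (h : i < l.length), a i = X ^ l[i]) :
    ∑ c : Composition l.length, M.μ c.length (fun i =>
      extendMonomials K f (c.blocksFun i) (fun j => a (c.embedding i j : ℕ))) =
      ∑ C ∈ blockings l, opList M.μ (C.map f) := by
  rw [sum_blockings l (fun C => opList M.μ (C.map f))]
  refine Finset.sum_congr rfl fun c _ => opList_eq (by simp) fun i => ?_
  have hi : (i : ℕ) < (l.splitWrtComposition c).length := by simp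
  have hlen : (l.splitWrtComposition c)[(i : ℕ)].length = c.blocksFun i := by
    rw [← List.getElem_map List.length (h := by simp)]
    exact List.getElem_of_eq (l.map_length_splitWrtComposition c) _
  rw [Fin.getElem_fin, List.getElem_map, ← opList_extendMonomials (K := K) f]
  refine opList_eq (by simpa using hlen) fun j => ?_
  rw [ha _ (c.embedding i j).2]
  simp [List.getElem_splitWrtComposition]

/-- The `A_∞`-homomorphism given by a family of maps on monomials without defect. -/
noncomputable def homOfDefectEqZero (f : List ℕ → V) (hf : ∀ l, f l ∈ 𝒱 (rdeg δ l + 1))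
    (hnil : f [] = 0) (hdefect : ∀ l, defect M (sgn (par δ)) f l = 0) :
    AInfHom (ofGradedAlgebra par (polynomialGrading K δ)) M where
  F := extendMonomials K f
  F_zero := by
    ext a
    have h := extendMonomials_apply (K := K) f (k := 0) Fin.elim0
    rw [List.ofFn_zero, hnil] at h
    rw [Subsingleton.elim a, h]
    rfl
  F_mem k g a ha := by
    have key := polynomialGrading_induction (K := K) (δ := δ) (d := k)
      (p := fun a => extendMonomials K f k (fun i => a i) ∈ 𝒱 ((∑ i, g i) + (1 - (k : G))))
      (fun i => if h : i < k then g ⟨i, h⟩ else 0) ?_ ?_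
      (fun i => if h : i < k then a ⟨i, h⟩ else 0) (fun i hi => by simpa [hi] using ha ⟨i, hi⟩)
    · simpa using key
    · intro b i hi
      obtain ⟨L, hL⟩ := linearAt_comp (extendMonomials K f k)
        (Φ := fun (j : Fin k) (a : ℕ → K[X]) => a j) (i := i) ⟨i, hi⟩ (linearAt_apply i)
        (fun j hj a x => Function.update_of_ne (fun h => hj (Fin.ext h)) _ _) b
      exact ⟨(𝒱 _).comap L, fun x => by rw [Submodule.mem_comap, hL]⟩
    · intro l b hl hg hb
      subst hl
      rw [opList_eq (w := l.map fun n => (X ^ n : K[X])) (by simp) (fun i => by simp [hb]),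
        opList_extendMonomials]
      convert hf l using 2
      have hr : ∀ l : List ℕ, rdeg δ l = ∑ i : Fin l.length, (l[i] : G) * δ - l.length := by
        intro l
        induction l with
        | nil => simp [rdeg_nil]
        | cons x l ih =>
          rw [rdeg_cons, ih]
          simp [Fin.sum_univ_succ]
          ring
      rw [hr, Finset.sum_congr rfl fun (i : Fin l.length) _ =>
        show g i = (l[i] : G) * δ by simpa using hg i i.2]
      ring
  relation d g a ha := by
    refine polynomialGrading_induction (K := K) (δ := δ) (d := d) (p := fun a =>
      ∑ c : Composition d, M.μ c.length (fun i =>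
        extendMonomials K f (c.blocksFun i) (fun j => a (c.embedding i j : ℕ))) =
      insertionSum par (gradedμ par (polynomialGrading K δ)) (extendMonomials K f) g a d)
      g ?_ ?_ a (fun i _ => ha i)
    · intro b i hi
      obtain ⟨L, hL⟩ := LinearAt.sum (s := Finset.univ) (fun (c : Composition d) _ =>
        linearAt_composition c (M.μ c.length) (extendMonomials K f) hi) b
      obtain ⟨L', hL'⟩ := linearAt_insertionSum par (gradedμ par (polynomialGrading K δ))
        (extendMonomials K f) g hi b
      exact ⟨LinearMap.eqLocus L L', fun x => by rw [LinearMap.mem_eqLocus, hL, hL']⟩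
    · intro l b hl hg hb
      subst hl
      rw [sum_composition_extendMonomials f l hb, insertionSum_extendMonomials f l hg hb]
      exact sub_eq_zero.1 (hdefect l)

/-- The polynomial algebra on one generator of any degree is intrinsically formal. -/
theorem intrinsicallyFormal_polynomialGrading (par : G →+* ZMod 2) (δ : G) :
    IntrinsicallyFormal par (polynomialGrading K δ) := by
  rintro V _ _ 𝒱 _ M ⟨e⟩
  obtain ⟨f, hf⟩ := exists_isPartialHom_forall e
  let Φ : AInfHom (ofGradedAlgebra par (polynomialGrading K δ)) M :=
    homOfDefectEqZero f (hf 0).mem (hf 0).nil (fun l => (hf _).defect_eq_zero l le_rfl)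
  have hlin : ∀ p : K[X], e.Represents (Φ.linearPart p) p := by
    intro p
    induction p using Polynomial.induction_on' with
    | add p q hp hq => rw [map_add]; exact hp.add hq
    | monomial n c =>
      have h : Φ.linearPart (X ^ n) = f [n] := by
        rw [← opList_extendMonomials (K := K) f]
        change extendMonomials K f 1 (fun _ => X ^ n) = _
        exact opList_eq (w := [n].map fun n => (X ^ n : K[X])) (k := 1) rfl fun i => by simp
      rw [← C_mul_X_pow_eq_monomial, ← smul_eq_C_mul, map_smul, h]
      exact ((hf 0).represents n).smul c
  have hmap : ∀ x : LinearMap.ker (ofGradedAlgebra par (polynomialGrading K δ)).d,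
      Φ.cohomologyMap ((ofGradedAlgebra par (polynomialGrading K δ)).coboundaries.mkQ x) =
        e.toEquiv x := by
    intro x
    obtain ⟨h, h'⟩ := hlin x
    rw [h']
    rfl
  have hd : ∀ p : K[X], (ofGradedAlgebra par (polynomialGrading K δ)).d p = 0 := fun p => rfl
  refine ⟨Φ, ?_, ?_⟩
  · rw [← AddMonoidHom.coe_coe, injective_iff_map_eq_zero]
    intro q hq
    obtain ⟨x, rfl⟩ := Submodule.mkQ_surjective _ q
    have hx : e.toEquiv (x : K[X]) = 0 := (hmap x).symm.trans hq
    rw [EmbeddingLike.map_eq_zero_iff] at hx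
    rw [(Subtype.ext hx : x = 0), map_zero]
  · intro q
    obtain ⟨p, rfl⟩ := e.toEquiv.surjective q
    exact ⟨_, hmap ⟨p, hd p⟩⟩

end Hom

end AInf

theorem mainTheorem10 (K : Type*) [Field K] (n : ℕ) (hn : 2 ≤ n) :
    AInf.IntrinsicallyFormal (Int.castRingHom (ZMod 2))
        (AInf.polynomialGrading K (1 - (n : ℤ))) ∧
      AInf.IntrinsicallyFormal (RingHom.id (ZMod 2))
        (AInf.polynomialGrading K (1 - (n : ZMod 2))) := by
  exact ⟨AInf.intrinsicallyFormal_polynomialGrading _ _,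
    AInf.intrinsicallyFormal_polynomialGrading _ _⟩
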